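/- Let $\ell>0$, $0<\sigma<\tfrac12$, $\Omega=(0,\pi)\times(-\ell,\ell)\subset\mathbb R^2$, and $$H^2_*(\Omega)=\{u\in H^2(\Omega):\ u=0 \text{ on } \{0,\pi\}\times(-\ell,\ell)\},$$ $$(u,v)_{H^2_*}=\int_\Omega\big[\Delta u\,\Delta v+(1-\sigma)(2u_{xy}v_{xy}-u_{xx}v_{yy}-u_{yy}v_{xx})\big]\,dx\,dy .$$ Let $m\ge 1$ be an integer, let $f\in L^2(-\ell,\ell)$, and let $u\in H^2_*(\Omega)$ be the weak solution to the partially hinged plate problem $$\begin{cases}\Delta^2u=f(y)\sin(mx)&\text{in }\Omega,\\ u(0,y)=u_{xx}(0,y)=u(\pi,y)=u_{xx}(\pi,y)=0&\text{for }y\in(-\ell,\ell),\\ u_{yy}(x,\pm\ell)+\sigma u_{xx}(x,\pm\ell)=u_{yyy}(x,\pm\ell)+(2-\sigma)u_{xxy}(x,\pm\ell)=0&\text{for }x\in(0,\pi),\end{cases}$$ namely $$(u,v)_{H^2_*}=\int_\Omega f(y)\sin(mx)\,v\,dx\,dy\qquad\text{for all }v\in H^2_*(\Omega).$$ Then there is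 $w_m\in H^2(-\ell,\ell)\subset C^0([-\ell,\ell])$ such that $u(x,y)=w_m(y)\sin(mx)$ for almost every $(x,y)\in\Omega$. Moreover, if $f\ge0$ a.e. in $(-\ell,\ell)$ and $f$ is not a.e. equal to $0$, then (for the continuous representative) $w_m(y)>0$ for every $y\in[-\ell,\ell]$. -/

import Mathlib

open MeasureTheory Set
open scoped ContDiff

namespace HingedPlate

section Sobolev

variable {E : Type*} [NormedAddCommGroup E] [NormedSpace ℝ E] [MeasureSpace E]

/-- `g` is the weak derivative of `u` in the direction `e` on the open set `U`: both functions are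
locally integrable in `U`, and `∫ u ∂ₑφ = - ∫ g φ` for all test functions `φ ∈ C_c^∞(U)`. -/
def HasWeakDeriv (U : Set E) (e : E) (u g : E → ℝ) : Prop :=
  LocallyIntegrableOn u U ∧ LocallyIntegrableOn g U ∧
    ∀ φ : E → ℝ, ContDiff ℝ ∞ φ → HasCompactSupport φ → tsupport φ ⊆ U →
      ∫ x in U, u x * fderiv ℝ φ x e = -∫ x in U, g x * φ x

open Classical in
/-- The weak derivative of `u` in the direction `e` on `U` (unique up to null sets), and `0` if
there is none. -/
noncomputable def weakDeriv (U : Set E) (e : E) (u : E → ℝ) : E → ℝ :=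
  if h : ∃ g, HasWeakDeriv U e u g then h.choose else 0

/-- The Sobolev space `H^k(U) = W^{k,2}(U)`: the weak derivatives of order at most `k`, in all
directions, exist and are square integrable on `U`. -/
def MemH (U : Set E) : ℕ → (E → ℝ) → Prop
  | 0, u => MemLp u 2 (volume.restrict U)
  | k + 1, u => MemLp u 2 (volume.restrict U) ∧
      ∀ e : E, ∃ g : E → ℝ, HasWeakDeriv U e u g ∧ MemH U k g

theorem HasWeakDeriv.weakDeriv {U : Set E} {e : E} {u g : E → ℝ} (h : HasWeakDeriv U e u g) :
    HasWeakDeriv U e u (weakDeriv U e u) := by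
  have h' : ∃ g, HasWeakDeriv U e u g := ⟨g, h⟩
  rw [HingedPlate.weakDeriv, dif_pos h']
  exact h'.choose_spec

/-- Weak derivatives are unique up to null sets. -/
theorem HasWeakDeriv.ae_eq [FiniteDimensional ℝ E] [BorelSpace E] {U : Set E} (hU : IsOpen U)
    {e : E} {u g₁ g₂ : E → ℝ} (h₁ : HasWeakDeriv U e u g₁) (h₂ : HasWeakDeriv U e u g₂) :
    g₁ =ᵐ[volume.restrict U] g₂ := by
  have int : ∀ g : E → ℝ, LocallyIntegrableOn g U → ∀ φ : E → ℝ, ContDiff ℝ ∞ φ →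
      HasCompactSupport φ → tsupport φ ⊆ U → Integrable (fun x => φ x * g x) := by
    intro g hg φ hφ hc hs
    have hgc : IntegrableOn g (tsupport φ) := hg.integrableOn_compact_subset hs hc
    have h0 : IntegrableOn (fun x => φ x * g x) (tsupport φ) :=
      hgc.continuousOn_mul hφ.continuous.continuousOn hc
    refine (integrableOn_iff_integrable_of_support_subset ?_).1 h0
    intro x hx
    exact subset_tsupport φ (fun h => hx (by simp [h]))
  have key := hU.ae_eq_zero_of_integral_contDiff_smul_eq_zero (μ := volume) (f := g₁ - g₂)
    (h₁.2.1.sub h₂.2.1) (by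
      intro φ hφ hc hs
      have e₁ := h₁.2.2 φ hφ hc hs
      have e₂ := h₂.2.2 φ hφ hc hs
      have full : ∀ g : E → ℝ, ∫ x in U, g x * φ x = ∫ x, φ x * g x := by
        intro g
        rw [setIntegral_eq_integral_of_forall_compl_eq_zero]
        · simp only [mul_comm]
        · intro x hx
          rw [image_eq_zero_of_notMem_tsupport (fun h => hx (hs h)), mul_zero]
      rw [full] at e₁ e₂
      simp only [Pi.sub_apply, smul_eq_mul, mul_sub]
      rw [integral_sub (int g₁ h₁.2.1 φ hφ hc hs) (int g₂ h₂.2.1 φ hφ hc hs)]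
      linarith)
  rw [Filter.EventuallyEq, ae_restrict_iff' hU.measurableSet]
  filter_upwards [key] with x hx hxU
  simpa [sub_eq_zero] using hx hxU

end Sobolev

/-- The open rectangle `(0, π) × (-ℓ, ℓ)`. -/
def plate (ℓ : ℝ) : Set (ℝ × ℝ) := Ioo 0 Real.pi ×ˢ Ioo (-ℓ) ℓ

/-- The weak partial derivative with respect to `x` on the plate. -/
noncomputable def dx (ℓ : ℝ) (u : ℝ × ℝ → ℝ) : ℝ × ℝ → ℝ := weakDeriv (plate ℓ) (1, 0) u

/-- The weak partial derivative with respect to `y` on the plate. -/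
noncomputable def dy (ℓ : ℝ) (u : ℝ × ℝ → ℝ) : ℝ × ℝ → ℝ := weakDeriv (plate ℓ) (0, 1) u

/-- The space `H²_*(Ω)` of the functions `u ∈ H²(Ω)` with `u = 0` on `{0, π} × (-ℓ, ℓ)`.
As `H²(Ω) ⊆ C⁰(closure Ω)` for a rectangle, the boundary values are those of the representative of
`u` that is continuous on the closed rectangle. -/
def MemH2Star (ℓ : ℝ) (u : ℝ × ℝ → ℝ) : Prop :=
  MemH (plate ℓ) 2 u ∧
    ∃ U : ℝ × ℝ → ℝ, ContinuousOn U (closure (plate ℓ)) ∧ u =ᵐ[volume.restrict (plate ℓ)] U ∧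
      ∀ y ∈ Ioo (-ℓ) ℓ, U (0, y) = 0 ∧ U (Real.pi, y) = 0

/-- The scalar product
`(u, v) = ∫_Ω [Δu Δv + (1 - σ) (2 u_xy v_xy - u_xx v_yy - u_yy v_xx)]` of `H²_*(Ω)`. -/
noncomputable def scalarProd (ℓ σ : ℝ) (u v : ℝ × ℝ → ℝ) : ℝ :=
  ∫ p in plate ℓ,
    ((dx ℓ (dx ℓ u) p + dy ℓ (dy ℓ u) p) * (dx ℓ (dx ℓ v) p + dy ℓ (dy ℓ v) p) +
      (1 - σ) * (2 * dy ℓ (dx ℓ u) p * dy ℓ (dx ℓ v) p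
        - dx ℓ (dx ℓ u) p * dy ℓ (dy ℓ v) p - dy ℓ (dy ℓ u) p * dx ℓ (dx ℓ v) p))

/-- `u ∈ H²_*(Ω)` is a weak solution of `Δ²u = F` in `Ω` with the partially hinged boundary
conditions. -/
def IsWeakSolution (ℓ σ : ℝ) (F u : ℝ × ℝ → ℝ) : Prop :=
  MemH2Star ℓ u ∧
    ∀ v : ℝ × ℝ → ℝ, MemH2Star ℓ v → scalarProd ℓ σ u v = ∫ p in plate ℓ, F p * v p

end HingedPlate

/-!
The solution is found explicitly by separation of variables. Put `s = 1 - σ`. If `w` solves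
`w'''' - 2 m² w'' + m⁴ w = f` on `(-ℓ, ℓ)` with `w'' = σ m² w` and `w''' = (2 - σ) m² w'` at `±ℓ`,
then `w(y) sin (m x)` is a weak solution, and weak solutions are unique.

*The problem for `w`.* With `h = w'' - m² w` the equation is `h'' - m² h = f`, and the boundary
conditions are `h = -s m² w`, `h' = s m² w'`. With `[·]` for the increment from `-ℓ` to `ℓ`, its
weak form is
`∫ h (v'' - m² v) + s m² [w v' + w' v] = ∫ f v`, and the quadratic form
`E(v) = ∫ (v'' - m² v)² + 2 s m² [v v']` is coercive (`eq_zero_of_energy_nonpos`). Hence the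
homogeneous problem has only the zero solution and the inhomogeneous one is solvable
(`exists_modeSystem`).

*Positivity.* Let `W'' - m² W = -|h|` with `W = |w|` at `±ℓ`. By the maximum principle `W ≥ |w|`,
with equality at `±ℓ`; comparing the derivatives there gives `[W W'] ≤ [w w']`, so `E(W) ≤ E(w)`. If
`f ≥ 0`, then also `∫ f W ≥ ∫ f w`, so `W` minimizes `½ E(v) - ∫ f v` as `w` does, and `W = w`.
Therefore `w ≥ 0` and `h ≤ 0` (`ModeSystem.nonneg_and_nonpos`). A zero of `w` in `[-ℓ, ℓ]`
propagates to an endpoint where `h` and `h'` vanish as well, and Green's formula against a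
hyperbolic sine then forces `f = 0` (`ModeSystem.ae_eq_zero_of_eq_zero`).

*The plate.* The bilinear form is integrated by parts against functions `β(x) κ(y)` that do not
vanish near the boundary. Integrating out one variable reduces this to one dimension, where a weakly
differentiable function is a primitive of its derivative (`TensorWeakDeriv.integral_mul`). The
boundary terms on `x = 0, π` vanish because the function of `H²_*` or the sine does, those on
`y = ±ℓ` because of the conditions on `w`. For the difference `z` of two weak solutions the form
controls `z_xx`, so `z_xx = 0`, and two integrations by parts in `x` give `∫ z β'' κ = 0` whenever
`β` vanishes at `0` and `π`; since `β''` is arbitrary, `z = 0` (`IsWeakSolution.ae_eq`).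
-/

open scoped Topology

namespace HingedPlate

/-! ### The equation `y'' = m² y + g` and integration by parts -/

theorem hasDerivAt_sinh_mul_sub (m a t : ℝ) :
    HasDerivAt (fun t => Real.sinh (m * (t - a))) (m * Real.cosh (m * (t - a))) t := by
  have := (((hasDerivAt_id t).sub_const a).const_mul m).sinh
  simpa [mul_comm] using this

theorem hasDerivAt_cosh_mul_sub (m a t : ℝ) :
    HasDerivAt (fun t => Real.cosh (m * (t - a))) (m * Real.sinh (m * (t - a))) t := by
  have := (((hasDerivAt_id t).sub_const a).const_mul m).cosh
  simpa [mul_comm] using this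

theorem hasDerivAt_mul_cosh_mul_sub (m a t : ℝ) :
    HasDerivAt (fun t => m * Real.cosh (m * (t - a))) (m ^ 2 * Real.sinh (m * (t - a))) t := by
  convert! (hasDerivAt_cosh_mul_sub m a t).const_mul m using 1
  ring

/-- The initial value problem for `y'' = m² y + g`, solved by variation of constants. -/
theorem exists_hasDerivAt_of_linear_ode {m : ℝ} (hm : m ≠ 0) {g : ℝ → ℝ} (hg : Continuous g)
    (a α β : ℝ) :
    ∃ y y₁ : ℝ → ℝ, (∀ t, HasDerivAt y (y₁ t) t) ∧
      (∀ t, HasDerivAt y₁ (m ^ 2 * y t + g t) t) ∧ y a = α ∧ y₁ a = β := by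
  have hC : ∀ t, HasDerivAt (fun t => ∫ τ in a..t, Real.cosh (m * (τ - a)) * g τ)
      (Real.cosh (m * (t - a)) * g t) t := fun t =>
    (Continuous.integral_hasStrictDerivAt (by fun_prop) a t).hasDerivAt
  have hS : ∀ t, HasDerivAt (fun t => ∫ τ in a..t, Real.sinh (m * (τ - a)) * g τ)
      (Real.sinh (m * (t - a)) * g t) t := fun t =>
    (Continuous.integral_hasStrictDerivAt (by fun_prop) a t).hasDerivAt
  set C := fun t => ∫ τ in a..t, Real.cosh (m * (τ - a)) * g τ with hCd
  set S := fun t => ∫ τ in a..t, Real.sinh (m * (τ - a)) * g τ with hSd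
  refine ⟨fun t => Real.cosh (m * (t - a)) * (α - S t / m)
      + Real.sinh (m * (t - a)) * (β / m + C t / m),
    fun t => Real.sinh (m * (t - a)) * (m * α - S t) + Real.cosh (m * (t - a)) * (β + C t),
    fun t => ?_, fun t => ?_, by simp [hSd], by simp [hCd]⟩
  · convert! ((hasDerivAt_cosh_mul_sub m a t).mul (((hS t).div_const m).const_sub α)).add
      ((hasDerivAt_sinh_mul_sub m a t).mul (((hC t).div_const m).const_add (β / m))) using 1
    field_simp
    ring
  · convert! ((hasDerivAt_sinh_mul_sub m a t).mul ((hS t).const_sub (m * α))).add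
      ((hasDerivAt_cosh_mul_sub m a t).mul ((hC t).const_add β)) using 1
    have := Real.cosh_sq (m * (t - a))
    field_simp
    linear_combination (-g t) * this

/-- Integration by parts for two primitives of integrable functions. -/
theorem integral_mul_eq_of_primitive {a b : ℝ} {p p₁ q q₁ : ℝ → ℝ}
    (hp₁ : IntervalIntegrable p₁ volume a b) (hq₁ : IntervalIntegrable q₁ volume a b)
    (hp : ∀ x, p x = p a + ∫ t in a..x, p₁ t) (hq : ∀ x, q x = q a + ∫ t in a..x, q₁ t) :
    ∫ x in a..b, p x * q₁ x = p b * q b - p a * q a - ∫ x in a..b, p₁ x * q x := by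
  have ac : ∀ r r₁ : ℝ → ℝ, IntervalIntegrable r₁ volume a b →
      (∀ x, r x = r a + ∫ t in a..x, r₁ t) → AbsolutelyContinuousOnInterval r a b ∧
      ∀ᵐ x, x ∈ uIoc a b → deriv r x = r₁ x := by
    intro r r₁ hr₁ hr
    have e : r = (fun _ => r a) + fun x => ∫ t in a..x, r₁ t := funext hr
    constructor
    · rw [e]
      exact (LipschitzOnWith.absolutelyContinuousOnInterval (K := 0)
        (LipschitzWith.const (r a)).lipschitzOnWith).add
        (hr₁.absolutelyContinuousOnInterval_intervalIntegral left_mem_uIcc)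
    · filter_upwards [hr₁.ae_hasDerivAt_integral] with x hx hxm
      rw [e]
      exact ((hx (uIoc_subset_uIcc hxm) a left_mem_uIcc).const_add (r a)).deriv
  obtain ⟨hpa, hpd⟩ := ac p p₁ hp₁ hp
  obtain ⟨hqa, hqd⟩ := ac q q₁ hq₁ hq
  have := hpa.integral_mul_deriv_eq_deriv_mul hqa
  rw [← intervalIntegral.integral_congr_ae (g := fun x => p x * q₁ x)
      (f := fun x => p x * deriv q x), this,
    intervalIntegral.integral_congr_ae (g := fun x => p₁ x * q x)
      (f := fun x => deriv p x * q x)]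
  · filter_upwards [hpd] with x hx hxm
    rw [hx hxm]
  · filter_upwards [hqd] with x hx hxm
    rw [hx hxm]

theorem eq_add_integral_of_hasDerivAt {p p₁ : ℝ → ℝ} (hp : ∀ t, HasDerivAt p (p₁ t) t)
    (hp₁ : Continuous p₁) (a x : ℝ) : p x = p a + ∫ t in a..x, p₁ t := by
  rw [intervalIntegral.integral_eq_sub_of_hasDerivAt (fun t _ => hp t)
    (hp₁.intervalIntegrable _ _)]
  ring

/-! ### The one-dimensional boundary value problem -/

/-- The fourth order equation `w'''' - 2 m² w'' + m⁴ w = f` written as the system `w' = w₁`,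
`w₁' = m² w + h`, `h' = h₁`, `h₁' = m² h + f`. As `f` is only integrable, the last equation is
stated in integrated form: `h₁ - ∫ f` is continuously differentiable with derivative `m² h`. -/
structure ModeSystem (m a : ℝ) (f w w₁ h h₁ : ℝ → ℝ) : Prop where
  deriv_w : ∀ t, HasDerivAt w (w₁ t) t
  deriv_w₁ : ∀ t, HasDerivAt w₁ (m ^ 2 * w t + h t) t
  deriv_h : ∀ t, HasDerivAt h (h₁ t) t
  deriv_h₁ : ∀ t, HasDerivAt (fun s => h₁ s - ∫ τ in a..s, f τ) (m ^ 2 * h t) t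

/-- The natural boundary conditions `w'' = σ m² w` and `w''' = (2 - σ) m² w'` at the point `c`, in
terms of `h = w'' - m² w`, with `s = 1 - σ`. -/
structure ModeBoundary (m s : ℝ) (w w₁ h h₁ : ℝ → ℝ) (c : ℝ) : Prop where
  moment : h c = -(s * m ^ 2 * w c)
  shear : h₁ c = s * m ^ 2 * w₁ c

namespace ModeSystem

variable {m a : ℝ} {f w w₁ h h₁ : ℝ → ℝ}

theorem continuous_w (S : ModeSystem m a f w w₁ h h₁) : Continuous w :=
  continuous_iff_continuousAt.2 fun t => (S.deriv_w t).continuousAt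

theorem continuous_w₁ (S : ModeSystem m a f w w₁ h h₁) : Continuous w₁ :=
  continuous_iff_continuousAt.2 fun t => (S.deriv_w₁ t).continuousAt

theorem continuous_h (S : ModeSystem m a f w w₁ h h₁) : Continuous h :=
  continuous_iff_continuousAt.2 fun t => (S.deriv_h t).continuousAt

theorem continuous_h₁ (S : ModeSystem m a f w w₁ h h₁) (hf : Integrable f) : Continuous h₁ := by
  have h1 : Continuous fun s => h₁ s - ∫ τ in a..s, f τ :=
    continuous_iff_continuousAt.2 fun t => (S.deriv_h₁ t).continuousAt
  have h2 : Continuous fun s => ∫ τ in a..s, f τ :=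
    intervalIntegral.continuous_primitive (fun _ _ => hf.intervalIntegrable) a
  exact (h1.add h2).congr fun s => by simp

theorem h₁_eq (S : ModeSystem m a f w w₁ h h₁) (hf : Integrable f) (x : ℝ) :
    h₁ x = h₁ a + ∫ t in a..x, (m ^ 2 * h t + f t) := by
  have hc : Continuous fun t => m ^ 2 * h t := continuous_const.mul S.continuous_h
  have := eq_add_integral_of_hasDerivAt S.deriv_h₁ hc a x
  rw [intervalIntegral.integral_add (hc.intervalIntegrable _ _) hf.intervalIntegrable]
  simp only [intervalIntegral.integral_same] at this
  linarith

/-- The initial value problem for the system. With `F = ∫ f` and `Φ = ∫ F`, the function `h - Φ`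
solves a second order equation with the continuous right-hand side `m² Φ`. -/
theorem exists_of_initial {m : ℝ} (hm : m ≠ 0) {f : ℝ → ℝ} (hf : Integrable f)
    (a α β γ δ : ℝ) :
    ∃ w w₁ h h₁ : ℝ → ℝ, ModeSystem m a f w w₁ h h₁ ∧ w a = α ∧ w₁ a = β ∧ h a = γ ∧ h₁ a = δ := by
  have hF : Continuous fun t => ∫ τ in a..t, f τ :=
    intervalIntegral.continuous_primitive (fun _ _ => hf.intervalIntegrable) a
  have hFF : ∀ t, HasDerivAt (fun t => ∫ r in a..t, ∫ τ in a..r, f τ) (∫ τ in a..t, f τ) t :=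
    fun t => (hF.integral_hasStrictDerivAt a t).hasDerivAt
  have hFFc : Continuous fun t => ∫ r in a..t, ∫ τ in a..r, f τ :=
    continuous_iff_continuousAt.2 fun t => (hFF t).continuousAt
  obtain ⟨y, y₁, hy, hy₁, hya, hy₁a⟩ := exists_hasDerivAt_of_linear_ode hm
    (continuous_const.mul hFFc : Continuous fun t => m ^ 2 * ∫ r in a..t, ∫ τ in a..r, f τ) a γ δ
  have hh : ∀ t, HasDerivAt (fun t => y t + ∫ r in a..t, ∫ τ in a..r, f τ)
    (y₁ t + ∫ τ in a..t, f τ) t := fun t => (hy t).add (hFF t)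
  obtain ⟨w, w₁, hw, hw₁, hwa, hw₁a⟩ := exists_hasDerivAt_of_linear_ode hm
    (continuous_iff_continuousAt.2 fun t => (hh t).continuousAt) a α β
  refine ⟨w, w₁, _, _, ⟨hw, hw₁, hh, fun t => ?_⟩, hwa, hw₁a, by simpa using hya,
    by simpa using hy₁a⟩
  simpa [mul_add] using hy₁ t

theorem add_smul {g v v₁ k k₁ : ℝ → ℝ} (S : ModeSystem m a f w w₁ h h₁)
    (T : ModeSystem m a g v v₁ k k₁) (hf : Integrable f) (hg : Integrable g) (c : ℝ) :
    ModeSystem m a (f + c • g) (w + c • v) (w₁ + c • v₁) (h + c • k) (h₁ + c • k₁) where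
  deriv_w t := (S.deriv_w t).add ((T.deriv_w t).const_smul c)
  deriv_w₁ t := by
    convert! (S.deriv_w₁ t).add ((T.deriv_w₁ t).const_smul c) using 1
    simp; ring
  deriv_h t := (S.deriv_h t).add ((T.deriv_h t).const_smul c)
  deriv_h₁ t := by
    convert! (S.deriv_h₁ t).add ((T.deriv_h₁ t).const_smul c) using 1
    · ext s
      simp only [Pi.add_apply, Pi.smul_apply, smul_eq_mul]
      rw [intervalIntegral.integral_add hf.intervalIntegrable (hg.intervalIntegrable.const_mul c),
        intervalIntegral.integral_const_mul]
      ring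
    · simp; ring

/-- Green's formula for the operator `h ↦ h'' - m² h`, where `h'' - m² h = f`. -/
theorem green (S : ModeSystem m a f w w₁ h h₁) (hf : Integrable f) (b : ℝ) {v v₁ v₂ : ℝ → ℝ}
    (hv : ∀ t, HasDerivAt v (v₁ t) t) (hv₁ : ∀ t, HasDerivAt v₁ (v₂ t) t) (hv₂ : Continuous v₂) :
    ∫ t in a..b, f t * v t = (∫ t in a..b, h t * (v₂ t - m ^ 2 * v t)) +
      (h₁ b * v b - h b * v₁ b) - (h₁ a * v a - h a * v₁ a) := by
  have cv : Continuous v := continuous_iff_continuousAt.2 fun t => (hv t).continuousAt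
  have cv₁ : Continuous v₁ := continuous_iff_continuousAt.2 fun t => (hv₁ t).continuousAt
  have ch := S.continuous_h
  have ch₁ := S.continuous_h₁ hf
  have if' : IntervalIntegrable f volume a b := hf.intervalIntegrable
  have e1 := integral_mul_eq_of_primitive (a := a) (b := b) (ch₁.intervalIntegrable _ _)
    (hv₂.intervalIntegrable _ _) (eq_add_integral_of_hasDerivAt S.deriv_h ch₁ a)
    (eq_add_integral_of_hasDerivAt hv₁ hv₂ a)
  have e2 := integral_mul_eq_of_primitive (a := a) (b := b)
    (p₁ := fun t => m ^ 2 * h t + f t)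
    (((by fun_prop : Continuous fun t => m ^ 2 * h t).intervalIntegrable _ _).add if')
    (cv₁.intervalIntegrable _ _) (S.h₁_eq hf)
    (eq_add_integral_of_hasDerivAt hv cv₁ a)
  have e3 : ∫ t in a..b, (m ^ 2 * h t + f t) * v t =
      m ^ 2 * (∫ t in a..b, h t * v t) + ∫ t in a..b, f t * v t := by
    rw [← intervalIntegral.integral_const_mul, ← intervalIntegral.integral_add]
    · congr 1; ext t; ring
    · exact (by fun_prop : Continuous fun t => m ^ 2 * (h t * v t)).intervalIntegrable _ _
    · exact if'.mul_continuousOn cv.continuousOn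
  have e4 : ∫ t in a..b, h t * (v₂ t - m ^ 2 * v t) =
      (∫ t in a..b, h t * v₂ t) - m ^ 2 * ∫ t in a..b, h t * v t := by
    rw [← intervalIntegral.integral_const_mul, ← intervalIntegral.integral_sub]
    · congr 1; ext t; ring
    · exact (by fun_prop : Continuous fun t => h t * v₂ t).intervalIntegrable _ _
    · exact (by fun_prop : Continuous fun t => m ^ 2 * (h t * v t)).intervalIntegrable _ _
  rw [e4, e1, e2, e3]
  ring

/-- The weak form of the boundary value problem. -/
theorem weak_form (S : ModeSystem m a f w w₁ h h₁) (hf : Integrable f) {s b : ℝ}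
    (ha : ModeBoundary m s w w₁ h h₁ a) (hb : ModeBoundary m s w w₁ h h₁ b) {v v₁ v₂ : ℝ → ℝ}
    (hv : ∀ t, HasDerivAt v (v₁ t) t) (hv₁ : ∀ t, HasDerivAt v₁ (v₂ t) t) (hv₂ : Continuous v₂) :
    (∫ t in a..b, h t * (v₂ t - m ^ 2 * v t)) +
      s * m ^ 2 * ((w b * v₁ b + w₁ b * v b) - (w a * v₁ a + w₁ a * v a)) =
    ∫ t in a..b, f t * v t := by
  rw [S.green hf b hv hv₁ hv₂, ha.moment, ha.shear, hb.moment, hb.shear]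
  ring

end ModeSystem

/-- Coercivity of the one-dimensional energy. -/
theorem eq_zero_of_energy_nonpos {m s a b : ℝ} (hm : m ≠ 0) (hs0 : 0 < s) (hs1 : s < 1)
    (hab : a < b) {v v₁ v₂ : ℝ → ℝ}
    (hv : ∀ t, HasDerivAt v (v₁ t) t) (hv₁ : ∀ t, HasDerivAt v₁ (v₂ t) t) (hv₂ : Continuous v₂)
    (hE : (∫ t in a..b, (v₂ t - m ^ 2 * v t) ^ 2) +
      2 * s * m ^ 2 * (v b * v₁ b - v a * v₁ a) ≤ 0) :
    ∀ t ∈ Icc a b, v t = 0 := by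
  have cv : Continuous v := continuous_iff_continuousAt.2 fun t => (hv t).continuousAt
  have cv₁ : Continuous v₁ := continuous_iff_continuousAt.2 fun t => (hv₁ t).continuousAt
  have ii : ∀ g : ℝ → ℝ, Continuous g → IntervalIntegrable g volume a b :=
    fun g hg => hg.intervalIntegrable _ _
  have e1 : v b * v₁ b - v a * v₁ a = ∫ t in a..b, (v₁ t * v₁ t + v t * v₂ t) :=
    (intervalIntegral.integral_eq_sub_of_hasDerivAt (f := fun t => v t * v₁ t)
      (fun t _ => (hv t).mul (hv₁ t)) (ii _ (by fun_prop))).symm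
  have e2 : (∫ t in a..b, (v₂ t - m ^ 2 * v t) ^ 2) +
      2 * s * m ^ 2 * (v b * v₁ b - v a * v₁ a) =
      ∫ t in a..b, ((v₂ t - m ^ 2 * v t) ^ 2 + 2 * s * m ^ 2 * (v₁ t * v₁ t + v t * v₂ t)) := by
    rw [e1, ← intervalIntegral.integral_const_mul, ← intervalIntegral.integral_add]
    · exact ii _ (by fun_prop)
    · exact ii _ (by fun_prop)
  have e3 : ∫ t in a..b, s * m ^ 4 * v t ^ 2 ≤ 0 := by
    refine le_trans (intervalIntegral.integral_mono_on hab.le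
      (ii _ (by fun_prop)) (ii _ (by fun_prop)) fun t _ => ?_) (e2 ▸ hE)
    -- the difference is `(1 - s) (v₂ - m² v)² + s v₂² + 2 s m² v₁²`
    have : 0 ≤ (1 - s) * (v₂ t - m ^ 2 * v t) ^ 2 + s * v₂ t ^ 2 + 2 * s * m ^ 2 * v₁ t ^ 2 := by
      have : 0 ≤ 1 - s := by linarith
      positivity
    linarith
  by_contra! hne
  obtain ⟨t, ht, hvt⟩ := hne
  have : 0 < ∫ t in a..b, s * m ^ 4 * v t ^ 2 :=
    intervalIntegral.integral_pos hab (Continuous.continuousOn (by fun_prop))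
      (fun t _ => by positivity) ⟨t, ht, by positivity⟩
  linarith

/-! ### Maximum principle and existence -/

theorem deriv_nonpos_of_nonneg_of_eq_zero_right {a b d' : ℝ} (hab : a < b) {d : ℝ → ℝ}
    (hd : HasDerivAt d d' b) (h0 : ∀ t ∈ Icc a b, 0 ≤ d t) (hb : d b = 0) : d' ≤ 0 := by
  have h1 := (hasDerivWithinAt_iff_tendsto_slope' (s := Iio b) (by simp)).1 hd.hasDerivWithinAt
  refine le_of_tendsto h1 ?_
  filter_upwards [Ioo_mem_nhdsLT hab] with t ht
  rw [slope_def_field, hb, sub_zero]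
  exact div_nonpos_of_nonneg_of_nonpos (h0 t ⟨ht.1.le, ht.2.le⟩) (by linarith [ht.2])

theorem deriv_nonneg_of_nonneg_of_eq_zero_left {a b d' : ℝ} (hab : a < b) {d : ℝ → ℝ}
    (hd : HasDerivAt d d' a) (h0 : ∀ t ∈ Icc a b, 0 ≤ d t) (ha : d a = 0) : 0 ≤ d' := by
  have h1 := (hasDerivWithinAt_iff_tendsto_slope' (s := Ioi a) (by simp)).1 hd.hasDerivWithinAt
  refine ge_of_tendsto h1 ?_
  filter_upwards [Ioo_mem_nhdsGT hab] with t ht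
  rw [slope_def_field, ha, sub_zero]
  exact div_nonneg (h0 t ⟨ht.1.le, ht.2.le⟩) (by linarith [ht.1])

/-- The maximum principle for `d'' - m² d ≤ 0`. -/
theorem nonneg_of_deriv2_le {m a b : ℝ} (hm : 0 < m) {d d₁ d₂ : ℝ → ℝ}
    (hd : ∀ t, HasDerivAt d (d₁ t) t) (hd₁ : ∀ t, HasDerivAt d₁ (d₂ t) t)
    (hle : ∀ t, d₂ t ≤ m ^ 2 * d t) (ha : 0 ≤ d a) (hb : 0 ≤ d b) :
    ∀ t ∈ Icc a b, 0 ≤ d t := by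
  intro t ht
  rcases eq_or_lt_of_le ht.1 with rfl | hat
  · exact ha
  have hpos : ∀ t, a < t → 0 < Real.sinh (m * (t - a)) := fun t ht =>
    Real.sinh_pos_iff.2 (mul_pos hm (by linarith))
  -- the Wronskian of `d` and `sinh (m (t - a))` decreases, and it is nonpositive at `a`
  have hp : ∀ t, HasDerivAt
      (fun t => d₁ t * Real.sinh (m * (t - a)) - d t * (m * Real.cosh (m * (t - a))))
      ((d₂ t - m ^ 2 * d t) * Real.sinh (m * (t - a))) t := by
    intro t
    convert! ((hd₁ t).mul (hasDerivAt_sinh_mul_sub m a t)).sub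
      ((hd t).mul (hasDerivAt_mul_cosh_mul_sub m a t)) using 1
    ring
  have hp0 : ∀ t, a ≤ t →
      d₁ t * Real.sinh (m * (t - a)) - d t * (m * Real.cosh (m * (t - a))) ≤ 0 := by
    have hanti : AntitoneOn
        (fun t => d₁ t * Real.sinh (m * (t - a)) - d t * (m * Real.cosh (m * (t - a))))
        (Ici a) := by
      refine antitoneOn_of_hasDerivWithinAt_nonpos (convex_Ici a)
        (fun t _ => (hp t).continuousAt.continuousWithinAt) (fun t _ => (hp t).hasDerivWithinAt)
        fun t ht => ?_
      rw [interior_Ici] at ht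
      exact mul_nonpos_of_nonpos_of_nonneg (by linarith [hle t]) (hpos t ht).le
    intro t ht
    refine (hanti self_mem_Ici ht ht).trans ?_
    simp only [sub_self, mul_zero, Real.sinh_zero, Real.cosh_zero, mul_one]
    nlinarith
  have hq : ∀ t, a < t → HasDerivAt (fun t => d t / Real.sinh (m * (t - a)))
      ((d₁ t * Real.sinh (m * (t - a)) - d t * (m * Real.cosh (m * (t - a)))) /
        Real.sinh (m * (t - a)) ^ 2) t := fun t ht =>
    (hd t).div (hasDerivAt_sinh_mul_sub m a t) (hpos t ht).ne'
  have hanti : AntitoneOn (fun t => d t / Real.sinh (m * (t - a))) (Ioi a) := by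
    refine antitoneOn_of_hasDerivWithinAt_nonpos (convex_Ioi a)
        (fun t ht => (hq t ht).continuousAt.continuousWithinAt)
        (fun t ht => (hq t (by simpa using ht)).hasDerivWithinAt) fun t ht => ?_
    rw [interior_Ioi] at ht
    exact div_nonpos_of_nonpos_of_nonneg (hp0 t (le_of_lt ht)) (sq_nonneg _)
  have h1 := hanti hat (lt_of_lt_of_le hat ht.2) ht.2
  have h2 : 0 ≤ d t / Real.sinh (m * (t - a)) :=
    le_trans (div_nonneg hb (hpos b (lt_of_lt_of_le hat ht.2)).le) h1
  simpa [div_mul_cancel₀ _ (hpos t hat).ne'] using mul_nonneg h2 (hpos t hat).le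

/-- The Dirichlet problem for `y'' = m² y + g` on `[a, b]`. -/
theorem exists_boundary_value_problem {m : ℝ} (hm : 0 < m) {g : ℝ → ℝ} (hg : Continuous g)
    {a b : ℝ} (hab : a < b) (α β : ℝ) :
    ∃ y y₁ : ℝ → ℝ, (∀ t, HasDerivAt y (y₁ t) t) ∧
      (∀ t, HasDerivAt y₁ (m ^ 2 * y t + g t) t) ∧ y a = α ∧ y b = β := by
  obtain ⟨y, y₁, hy, hy₁, hya, -⟩ := exists_hasDerivAt_of_linear_ode hm.ne' hg a α 0
  have hpos : 0 < Real.sinh (m * (b - a)) := Real.sinh_pos_iff.2 (mul_pos hm (by linarith))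
  set c := (β - y b) / Real.sinh (m * (b - a)) with hc
  refine ⟨fun t => y t + c * Real.sinh (m * (t - a)),
    fun t => y₁ t + c * (m * Real.cosh (m * (t - a))),
    fun t => (hy t).add ((hasDerivAt_sinh_mul_sub m a t).const_mul c), fun t => ?_,
    by simp [hya], ?_⟩
  · convert! (hy₁ t).add ((hasDerivAt_mul_cosh_mul_sub m a t).const_mul c) using 1
    ring
  · simp only [hc]
    field_simp
    ring

/-- The boundary value problem is solvable: the conditions at `b` are two linear equations for the
two free initial data at `a`, and coercivity of the energy makes the homogeneous equations uniquely
solvable. -/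
theorem exists_modeSystem {m s a b : ℝ} (hm : m ≠ 0) (hs0 : 0 < s) (hs1 : s < 1)
    (hab : a < b) {f : ℝ → ℝ} (hf : Integrable f) :
    ∃ w w₁ h h₁ : ℝ → ℝ, ModeSystem m a f w w₁ h h₁ ∧ ModeBoundary m s w w₁ h h₁ a ∧
      ModeBoundary m s w w₁ h h₁ b := by
  have h00 : Integrable (0 : ℝ → ℝ) := integrable_zero _ _ _
  obtain ⟨p, p₁, k, k₁, Sp, p0, p1, p2, p3⟩ := ModeSystem.exists_of_initial hm hf a 0 0 0 0
  obtain ⟨x, x₁, i, i₁, Sx, x0, x1, x2, x3⟩ :=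
    ModeSystem.exists_of_initial hm h00 a 1 0 (-(s * m ^ 2)) 0
  obtain ⟨y, y₁, j, j₁, Sy, y0, y1, y2, y3⟩ :=
    ModeSystem.exists_of_initial hm h00 a 0 1 0 (s * m ^ 2)
  -- the residuals at `b` of the solution with data `w a = α`, `w' a = β` and the conditions at `a`
  let T : ℝ × ℝ →ₗ[ℝ] ℝ × ℝ :=
    { toFun := fun q => (q.1 * (i b + s * m ^ 2 * x b) + q.2 * (j b + s * m ^ 2 * y b),
        q.1 * (i₁ b - s * m ^ 2 * x₁ b) + q.2 * (j₁ b - s * m ^ 2 * y₁ b))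
      map_add' := fun q r => by ext <;> simp <;> ring
      map_smul' := fun c q => by ext <;> simp <;> ring }
  have key : ∀ (α β : ℝ), T (α, β) = 0 → α = 0 ∧ β = 0 := by
    intro α β hT
    have hT1 : α * (i b + s * m ^ 2 * x b) + β * (j b + s * m ^ 2 * y b) = 0 :=
      congrArg Prod.fst hT
    have hT2 : α * (i₁ b - s * m ^ 2 * x₁ b) + β * (j₁ b - s * m ^ 2 * y₁ b) = 0 :=
      congrArg Prod.snd hT
    have S0 : ModeSystem m a (0 : ℝ → ℝ) 0 0 0 0 := by
      have h0 : ∀ t : ℝ, HasDerivAt (fun _ => (0 : ℝ)) 0 t := fun t => hasDerivAt_const t 0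
      exact ⟨h0, fun t => by simp, h0, fun t => by simpa using h0 t⟩
    have S1 := (S0.add_smul Sx h00 h00 α).add_smul Sy (by simp [h00]) h00 β
    simp only [smul_zero, add_zero, zero_add] at S1
    have hc : Continuous fun t => m ^ 2 * (α • x + β • y) t + (α • i + β • j) t :=
      (continuous_const.mul S1.continuous_w).add S1.continuous_h
    have E := S1.weak_form h00 (s := s) (b := b)
      ⟨by simp [x0, x2, y0, y2]; ring, by simp [x1, x3, y1, y3]; ring⟩
      ⟨by simp; linarith, by simp; linarith⟩ S1.deriv_w S1.deriv_w₁ hc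
    have hz := eq_zero_of_energy_nonpos hm hs0 hs1 hab S1.deriv_w S1.deriv_w₁ hc (by
      simp only [Pi.zero_apply, zero_mul, intervalIntegral.integral_zero] at E
      rw [← E, ← sub_nonneg]
      simp only [add_sub_cancel_left, ← sq]
      apply le_of_eq
      ring)
    have hα : α = 0 := by simpa [x0, y0] using hz a (left_mem_Icc.2 hab.le)
    refine ⟨hα, ?_⟩
    have hβ := S1.deriv_w a
    have hβ' : (α • x₁ + β • y₁) a = β := by simp [x1, y1]
    rw [hβ'] at hβ
    exact le_antisymm
      (by
        have := deriv_nonneg_of_nonneg_of_eq_zero_left hab hβ.neg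
          (fun t ht => by rw [Pi.neg_apply, hz t ht, neg_zero])
          (by rw [Pi.neg_apply, hz a (left_mem_Icc.2 hab.le), neg_zero])
        linarith)
      (deriv_nonneg_of_nonneg_of_eq_zero_left hab hβ (fun t ht => (hz t ht).ge)
        (hz a (left_mem_Icc.2 hab.le)))
  have hinj : Function.Injective T := by
    rw [← LinearMap.ker_eq_bot, LinearMap.ker_eq_bot']
    rintro ⟨α, β⟩ h
    obtain ⟨rfl, rfl⟩ := key α β h
    rfl
  obtain ⟨⟨α, β⟩, hT⟩ := (LinearMap.injective_iff_surjective.1 hinj)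
    (-(k b + s * m ^ 2 * p b), -(k₁ b - s * m ^ 2 * p₁ b))
  have hT1 : α * (i b + s * m ^ 2 * x b) + β * (j b + s * m ^ 2 * y b) = -(k b + s * m ^ 2 * p b) :=
    congrArg Prod.fst hT
  have hT2 : α * (i₁ b - s * m ^ 2 * x₁ b) + β * (j₁ b - s * m ^ 2 * y₁ b) =
    -(k₁ b - s * m ^ 2 * p₁ b) := congrArg Prod.snd hT
  have S1 := (Sp.add_smul Sx hf h00 α).add_smul Sy (by simpa using hf) h00 β
  simp only [smul_zero, add_zero] at S1
  exact ⟨_, _, _, _, S1,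
    ⟨by simp [p0, p2, x0, x2, y0, y2]; ring, by simp [p1, p3, x1, x3, y1, y3]; ring⟩,
    ⟨by simp; linarith, by simp; linarith⟩⟩

/-! ### Positivity -/

/-- If the integral of `f` against a positive weight is nonpositive and `f ≥ 0`, then `f = 0`. -/
theorem ae_eq_zero_of_integral_mul_nonpos {a b : ℝ} (hab : a < b) {f k : ℝ → ℝ}
    (hf : Integrable f) (hf0 : 0 ≤ᵐ[volume] f) (hk : Continuous k)
    (hk0 : ∀ t ∈ Ioo a b, 0 < k t) (hle : ∫ t in a..b, f t * k t ≤ 0) :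
    ∀ᵐ t ∂volume.restrict (Ioo a b), f t = 0 := by
  have hi : IntegrableOn (fun t => f t * k t) (Ioo a b) :=
    ((intervalIntegrable_iff_integrableOn_Ioo_of_le hab.le).1
      (hf.intervalIntegrable.mul_continuousOn hk.continuousOn))
  have hn : 0 ≤ᵐ[volume.restrict (Ioo a b)] fun t => f t * k t := by
    filter_upwards [ae_restrict_mem measurableSet_Ioo, ae_restrict_of_ae hf0] with t ht hft
    exact mul_nonneg hft (hk0 t ht).le
  rw [intervalIntegral.integral_of_le hab.le, integral_Ioc_eq_integral_Ioo] at hle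
  have h0 := (integral_eq_zero_iff_of_nonneg_ae hn hi).1
    (le_antisymm hle (integral_nonneg_of_ae hn))
  filter_upwards [h0, ae_restrict_mem measurableSet_Ioo] with t ht htm
  exact (mul_eq_zero.1 ht).resolve_right (hk0 t htm).ne'

namespace ModeSystem

variable {m s a b : ℝ} {f w w₁ h h₁ : ℝ → ℝ}

/-- For `f ≥ 0` the solution satisfies `w ≥ 0` and `w'' - m² w ≤ 0`: it coincides with the function
`W` such that `W'' - m² W = -|w'' - m² w|` and `W = |w|` at `a` and `b`, because `W ≥ |w|` has at
most the energy of `w`, and `w` minimizes `½ E(v) - ∫ f v`. -/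
theorem nonneg_and_nonpos (hm : 0 < m) (hs0 : 0 < s) (hs1 : s < 1) (hab : a < b)
    (S : ModeSystem m a f w w₁ h h₁) (ha : ModeBoundary m s w w₁ h h₁ a)
    (hb : ModeBoundary m s w w₁ h h₁ b) (hf : Integrable f) (hf0 : 0 ≤ᵐ[volume] f) :
    (∀ t ∈ Icc a b, 0 ≤ w t) ∧ ∀ t ∈ Icc a b, h t ≤ 0 := by
  have ch := S.continuous_h
  have cw := S.continuous_w
  obtain ⟨W, W₁, hW, hW₁, hWa, hWb⟩ :=
    exists_boundary_value_problem hm (ch.abs.neg) hab |w a| |w b|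
  simp only [Pi.neg_apply] at hW₁
  have cW : Continuous W := continuous_iff_continuousAt.2 fun t => (hW t).continuousAt
  have hz := fun t => (hW t).sub (S.deriv_w t)
  have hz₁ := fun t => (hW₁ t).sub (S.deriv_w₁ t)
  have hz0 := nonneg_of_deriv2_le (a := a) (b := b) hm hz hz₁
    (fun t => by simp only [Pi.sub_apply]; linarith [neg_abs_le (h t)])
    (by simp only [Pi.sub_apply]; linarith [le_abs_self (w a)])
    (by simp only [Pi.sub_apply]; linarith [le_abs_self (w b)])
  have hy := fun t => (hW t).add (S.deriv_w t)
  have hy₁ := fun t => (hW₁ t).add (S.deriv_w₁ t)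
  have hy0 := nonneg_of_deriv2_le (a := a) (b := b) hm hy hy₁
    (fun t => by simp only [Pi.add_apply]; linarith [le_abs_self (h t)])
    (by simp only [Pi.add_apply]; linarith [neg_abs_le (w a)])
    (by simp only [Pi.add_apply]; linarith [neg_abs_le (w b)])
  have hW0 := nonneg_of_deriv2_le (a := a) (b := b) hm hW hW₁
    (fun t => by linarith [abs_nonneg (h t)]) (by rw [hWa]; positivity) (by rw [hWb]; positivity)
  -- the boundary terms of the energy of `W` do not exceed those of `w`
  have hBb : W b * W₁ b ≤ w b * w₁ b := by
    rcases le_total 0 (w b) with h0 | h0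
    · have e : W b = w b := by rw [hWb, abs_of_nonneg h0]
      have := deriv_nonpos_of_nonneg_of_eq_zero_right hab (hz b) hz0 (by simp [e])
      rw [e]
      nlinarith
    · have e : W b = -w b := by rw [hWb, abs_of_nonpos h0]
      have := deriv_nonpos_of_nonneg_of_eq_zero_right hab (hy b) hy0 (by simp [e])
      rw [e]
      nlinarith
  have hBa : w a * w₁ a ≤ W a * W₁ a := by
    rcases le_total 0 (w a) with h0 | h0
    · have e : W a = w a := by rw [hWa, abs_of_nonneg h0]
      have := deriv_nonneg_of_nonneg_of_eq_zero_left hab (hz a) hz0 (by simp [e])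
      rw [e]
      nlinarith
    · have e : W a = -w a := by rw [hWa, abs_of_nonpos h0]
      have := deriv_nonneg_of_nonneg_of_eq_zero_left hab (hy a) hy0 (by simp [e])
      rw [e]
      nlinarith
  have ii : ∀ g : ℝ → ℝ, Continuous g → IntervalIntegrable g volume a b :=
    fun g hg => hg.intervalIntegrable _ _
  have E1 := S.weak_form hf ha hb S.deriv_w S.deriv_w₁ (by fun_prop)
  have E2 := S.weak_form hf ha hb hW hW₁ (by fun_prop)
  simp only [add_sub_cancel_left] at E1 E2
  have hfW : ∫ t in a..b, f t * w t ≤ ∫ t in a..b, f t * W t := by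
    refine intervalIntegral.integral_mono_ae_restrict hab.le
      (hf.intervalIntegrable.mul_continuousOn cw.continuousOn)
      (hf.intervalIntegrable.mul_continuousOn cW.continuousOn) ?_
    filter_upwards [ae_restrict_mem measurableSet_Icc, ae_restrict_of_ae hf0] with t ht hft
    exact mul_le_mul_of_nonneg_left (by simpa using hz0 t ht) hft
  have E3 : (∫ t in a..b, (m ^ 2 * W t + -|h t| - (m ^ 2 * w t + h t)
      - m ^ 2 * (W - w) t) ^ 2) =
      2 * (∫ t in a..b, h t * h t) - 2 * ∫ t in a..b, h t * -|h t| := by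
    rw [← intervalIntegral.integral_const_mul, ← intervalIntegral.integral_const_mul,
      ← intervalIntegral.integral_sub (ii _ (by fun_prop)) (ii _ (by fun_prop))]
    congr 1
    ext t
    simp only [Pi.sub_apply]
    linear_combination abs_mul_abs_self (h t)
  -- `½ E(v) - ∫ f v` is not larger at `W` than at its minimizer `w`, so `W = w`
  have hzero := eq_zero_of_energy_nonpos hm.ne' hs0 hs1 hab hz hz₁ (by fun_prop) (by
    rw [E3]
    simp only [Pi.sub_apply]
    have : 0 ≤ s * m ^ 2 * ((w b * w₁ b - W b * W₁ b) + (W a * W₁ a - w a * w₁ a)) :=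
      mul_nonneg (by positivity) (by linarith)
    linarith)
  have hwW : ∀ t ∈ Icc a b, W t = w t := fun t ht => by
    have := hzero t ht
    simp only [Pi.sub_apply] at this
    linarith
  refine ⟨fun t ht => hwW t ht ▸ hW0 t ht, ?_⟩
  have hev : ∀ {p p' : ℝ → ℝ}, (∀ t, HasDerivAt p (p' t) t) → (∀ t ∈ Ioo a b, p t = 0) →
      ∀ t ∈ Ioo a b, p' t = 0 := by
    intro p p' hp hp0 t ht
    have : p =ᶠ[𝓝 t] fun _ => 0 := by
      filter_upwards [Ioo_mem_nhds ht.1 ht.2] with x hx using hp0 x hx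
    exact (hp t).unique ((hasDerivAt_const t 0).congr_of_eventuallyEq this)
  have h2 := hev hz₁ (hev hz fun t ht => hzero t (Ioo_subset_Icc_self ht))
  have hcl : closure (Ioo a b) ⊆ {t | h t ≤ 0} := by
    refine closure_minimal (fun t ht => ?_) (isClosed_le ch continuous_const)
    have e1 := h2 t ht
    have e2 := hwW t (Ioo_subset_Icc_self ht)
    rw [e2] at e1
    change h t ≤ 0
    linarith [abs_nonneg (h t)]
  rw [closure_Ioo hab.ne] at hcl
  exact fun t ht => hcl ht

/-- Strict positivity: if `f ≥ 0` and `w` has a zero in the closed interval, then `f = 0`. -/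
theorem ae_eq_zero_of_eq_zero (hm : 0 < m) (hs0 : 0 < s) (hs1 : s < 1) (hab : a < b)
    (S : ModeSystem m a f w w₁ h h₁) (ha : ModeBoundary m s w w₁ h h₁ a)
    (hb : ModeBoundary m s w w₁ h h₁ b) (hf : Integrable f) (hf0 : 0 ≤ᵐ[volume] f)
    {y : ℝ} (hy : y ∈ Icc a b) (hwy : w y = 0) :
    ∀ᵐ t ∂volume.restrict (Ioo a b), f t = 0 := by
  obtain ⟨hw0, hh0⟩ := S.nonneg_and_nonpos hm hs0 hs1 hab ha hb hf hf0
  have cs : ∀ c, Continuous fun t => Real.sinh (m * (t - c)) := fun c => by fun_prop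
  have hh0' : ∀ t ∈ Icc a b, 0 ≤ (-h) t := fun t ht => by simpa using hh0 t ht
  -- a zero at the left end forces `h = h' = 0` there, hence `∫ f(t) sinh (m (b - t)) = m h(b) ≤ 0`
  have left : w a = 0 → ∀ᵐ t ∂volume.restrict (Ioo a b), f t = 0 := by
    intro h0
    have e1 : h a = 0 := by rw [ha.moment, h0]; ring
    have e2 := deriv_nonneg_of_nonneg_of_eq_zero_left hab (S.deriv_w a) hw0 h0
    have e3 := deriv_nonneg_of_nonneg_of_eq_zero_left hab (S.deriv_h a).neg hh0' (by simp [e1])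
    have e4 : h₁ a = 0 := by
      have : 0 ≤ h₁ a := by rw [ha.shear]; positivity
      linarith
    have G := S.green hf b (hasDerivAt_sinh_mul_sub m b) (hasDerivAt_mul_cosh_mul_sub m b)
      (by fun_prop)
    simp only [e1, e4, sub_self, mul_zero, intervalIntegral.integral_zero, Real.sinh_zero,
      Real.cosh_zero, mul_one, zero_mul, sub_zero, zero_add, zero_sub] at G
    refine ae_eq_zero_of_integral_mul_nonpos (k := fun t => -Real.sinh (m * (t - b))) hab hf hf0
      (cs b).neg (fun t ht => ?_) ?_
    · simp only [Left.neg_pos_iff, Real.sinh_neg_iff]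
      exact mul_neg_of_pos_of_neg hm (by linarith [ht.2])
    · simp only [mul_neg, intervalIntegral.integral_neg, G]
      nlinarith [hh0 b (right_mem_Icc.2 hab.le)]
  have right : w b = 0 → ∀ᵐ t ∂volume.restrict (Ioo a b), f t = 0 := by
    intro h0
    have e1 : h b = 0 := by rw [hb.moment, h0]; ring
    have e2 := deriv_nonpos_of_nonneg_of_eq_zero_right hab (S.deriv_w b) hw0 h0
    have e3 := deriv_nonpos_of_nonneg_of_eq_zero_right hab (S.deriv_h b).neg hh0' (by simp [e1])
    have e4 : h₁ b = 0 := by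
      have : h₁ b ≤ 0 := by
        rw [hb.shear]
        exact mul_nonpos_of_nonneg_of_nonpos (by positivity) e2
      linarith
    have G := S.green hf b (hasDerivAt_sinh_mul_sub m a) (hasDerivAt_mul_cosh_mul_sub m a)
      (by fun_prop)
    simp only [e1, e4, sub_self, mul_zero, intervalIntegral.integral_zero, Real.sinh_zero,
      Real.cosh_zero, mul_one, zero_mul, zero_add, zero_sub] at G
    refine ae_eq_zero_of_integral_mul_nonpos hab hf hf0 (cs a) (fun t ht => ?_) ?_
    · exact Real.sinh_pos_iff.2 (mul_pos hm (by linarith [ht.1]))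
    · rw [G]
      nlinarith [hh0 a (left_mem_Icc.2 hab.le)]
  rcases eq_or_lt_of_le hy.1 with rfl | hay
  · exact left hwy
  rcases eq_or_lt_of_le hy.2 with rfl | hyb
  · exact right hwy
  -- at an interior zero also `w' = 0`, and `w'' - m² w = h ≤ 0` propagates `w ≤ 0` up to `b`
  have hw₁y : w₁ y = 0 := le_antisymm
    (deriv_nonpos_of_nonneg_of_eq_zero_right hay (S.deriv_w y)
      (fun t ht => hw0 t ⟨ht.1, ht.2.trans hy.2⟩) hwy)
    (deriv_nonneg_of_nonneg_of_eq_zero_left hyb (S.deriv_w y)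
      (fun t ht => hw0 t ⟨hy.1.trans ht.1, ht.2⟩) hwy)
  refine right (le_antisymm ?_ (hw0 b (right_mem_Icc.2 hab.le)))
  have hd : ∀ t, HasDerivAt
      (fun t => w t * (m * Real.cosh (m * (t - b))) - w₁ t * Real.sinh (m * (t - b)))
      (-(h t * Real.sinh (m * (t - b)))) t := by
    intro t
    convert! ((S.deriv_w t).mul (hasDerivAt_mul_cosh_mul_sub m b t)).sub
      ((S.deriv_w₁ t).mul (hasDerivAt_sinh_mul_sub m b t)) using 1
    ring
  have hanti : AntitoneOn
      (fun t => w t * (m * Real.cosh (m * (t - b))) - w₁ t * Real.sinh (m * (t - b)))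
      (Icc y b) := by
    refine antitoneOn_of_hasDerivWithinAt_nonpos (convex_Icc y b)
      (fun t _ => (hd t).continuousAt.continuousWithinAt) (fun t _ => (hd t).hasDerivWithinAt)
      fun t ht => ?_
    rw [interior_Icc] at ht
    have : Real.sinh (m * (t - b)) ≤ 0 :=
      Real.sinh_nonpos_iff.2 (mul_nonpos_of_nonneg_of_nonpos hm.le (by linarith [ht.2]))
    nlinarith [hh0 t ⟨hy.1.trans ht.1.le, ht.2.le⟩]
  have := hanti (left_mem_Icc.2 hyb.le) (right_mem_Icc.2 hyb.le) hyb.le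
  simp only [sub_self, mul_zero, Real.cosh_zero, Real.sinh_zero, mul_one, sub_zero, hwy, hw₁y,
    zero_mul] at this
  exact nonpos_of_mul_nonpos_left this hm

end ModeSystem

/-! ### Weak derivatives on an interval -/

/-- `φ` is a test function on `U ⊆ ℝ`, that is, `φ ∈ C_c^∞(U)`. -/
structure IsTest (U : Set ℝ) (φ : ℝ → ℝ) : Prop where
  contDiff : ContDiff ℝ ∞ φ
  hasCompactSupport : HasCompactSupport φ
  tsupport_subset : tsupport φ ⊆ U

theorem setIntegral_Ioo_eq_intervalIntegral {a b : ℝ} (hab : a ≤ b) (g : ℝ → ℝ) :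
    ∫ t in Ioo a b, g t = ∫ t in a..b, g t := by
  rw [intervalIntegral.integral_of_le hab, integral_Ioc_eq_integral_Ioo]

namespace IsTest

variable {a b : ℝ} {U : Set ℝ} {φ ψ : ℝ → ℝ}

theorem continuous (h : IsTest U φ) : Continuous φ := h.contDiff.continuous

theorem hasDerivAt (h : IsTest U φ) (t : ℝ) : HasDerivAt φ (deriv φ t) t :=
  (h.contDiff.differentiable (by simp) t).hasDerivAt

theorem continuous_deriv (h : IsTest U φ) : Continuous (deriv φ) :=
  h.contDiff.continuous_deriv (by simp)

theorem eq_zero (h : IsTest U φ) {x : ℝ} (hx : x ∉ U) : φ x = 0 :=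
  image_eq_zero_of_notMem_tsupport fun hm => hx (h.tsupport_subset hm)

theorem sub_smul (hφ : IsTest U φ) (hψ : IsTest U ψ) (c : ℝ) :
    IsTest U (fun t => φ t - c * ψ t) where
  contDiff := hφ.contDiff.sub (contDiff_const.mul hψ.contDiff)
  hasCompactSupport := hφ.hasCompactSupport.sub (hψ.hasCompactSupport.mul_left (f := fun _ => c))
  tsupport_subset := (tsupport_sub _ _).trans
    (union_subset hφ.tsupport_subset
      ((tsupport_mul_subset_right (f := fun _ => c)).trans hψ.tsupport_subset))

theorem exists_integral_eq_one (hab : a < b) : ∃ η, IsTest (Ioo a b) η ∧ ∫ t, η t = 1 := by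
  let B : ContDiffBump ((a + b) / 2) := ⟨(b - a) / 8, (b - a) / 4, by linarith, by linarith⟩
  refine ⟨B.normed volume, ⟨B.contDiff_normed, B.hasCompactSupport_normed, ?_⟩,
    B.integral_normed⟩
  rw [B.tsupport_normed_eq, Real.closedBall_eq_Icc]
  intro t ht
  simp only [B, mem_Icc] at ht
  constructor <;> linarith [ht.1, ht.2]

theorem setIntegral_eq (h : IsTest (Ioo a b) φ) (g : ℝ → ℝ) :
    ∫ t in Ioo a b, g t * φ t = ∫ t, g t * φ t :=
  setIntegral_eq_integral_of_forall_compl_eq_zero fun t ht => by rw [h.eq_zero ht, mul_zero]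

/-- A test function of integral zero has a primitive that is a test function. -/
theorem exists_primitive (h : IsTest (Ioo a b) φ) (h0 : ∫ t, φ t = 0) :
    ∃ β, IsTest (Ioo a b) β ∧ deriv β = φ := by
  have hd : ∀ t, HasDerivAt (fun t => ∫ r in a..t, φ r) (φ t) t := fun t =>
    (h.continuous.integral_hasStrictDerivAt a t).hasDerivAt
  have hde : deriv (fun t => ∫ r in a..t, φ r) = φ := funext fun t => (hd t).deriv
  have hK : IsCompact (tsupport φ) := h.hasCompactSupport
  rcases (tsupport φ).eq_empty_or_nonempty with he | hne
  · have : φ = 0 := tsupport_eq_empty_iff.1 he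
    subst this
    exact ⟨0, h, by ext; simp⟩
  have hc := h.tsupport_subset (hK.sInf_mem hne)
  have hd' := h.tsupport_subset (hK.sSup_mem hne)
  have hsub : tsupport (fun t => ∫ r in a..t, φ r) ⊆
      Icc (sInf (tsupport φ)) (sSup (tsupport φ)) := by
    refine closure_minimal (fun t ht => ?_) isClosed_Icc
    by_contra hn
    refine ht ?_
    rw [mem_Icc, not_and_or, not_le, not_le] at hn
    have hz : ∀ r, r ∉ Icc (sInf (tsupport φ)) (sSup (tsupport φ)) → φ r = 0 := fun r hr =>
      image_eq_zero_of_notMem_tsupport fun hm =>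
        hr ⟨csInf_le hK.bddBelow hm, le_csSup hK.bddAbove hm⟩
    have hz' : ∀ {x y : ℝ}, (∀ r ∈ uIcc x y, r ∉ Icc (sInf (tsupport φ)) (sSup (tsupport φ))) →
        ∫ r in x..y, φ r = 0 := fun hxy => by
      rw [intervalIntegral.integral_congr (g := fun _ => 0) fun r hr => hz r (hxy r hr)]
      simp
    rcases hn with hn | hn
    · refine hz' fun r hr hr' => ?_
      have : r ≤ max a t := hr.2
      exact absurd hr'.1 (not_le.2 (lt_of_le_of_lt this (max_lt hc.1 hn)))
    · have h1 : ∫ r in a..b, φ r = 0 := by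
        rw [intervalIntegral.integral_of_le (hc.1.trans hc.2).le, integral_Ioc_eq_integral_Ioo]
        simpa [h0] using h.setIntegral_eq (fun _ => 1)
      have h2 : ∫ r in t..b, φ r = 0 := hz' fun r hr hr' => by
        have : min t b ≤ r := hr.1
        exact absurd hr'.2 (not_le.2 (lt_of_lt_of_le (lt_min hn hd'.2) this))
      have := intervalIntegral.integral_add_adjacent_intervals
        (h.continuous.intervalIntegrable (μ := volume) a t) (h.continuous.intervalIntegrable t b)
      change ∫ r in a..t, φ r = 0
      linarith
  refine ⟨_, ⟨?_, ?_, hsub.trans fun t ht => ⟨hc.1.trans_le ht.1, ht.2.trans_lt hd'.2⟩⟩, hde⟩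
  · rw [contDiff_infty_iff_deriv, hde]
    exact ⟨fun t => (hd t).differentiableAt, h.contDiff⟩
  · exact isCompact_Icc.of_isClosed_subset (isClosed_tsupport _) hsub

end IsTest

/-- A function on an interval whose weak derivative vanishes is constant. -/
theorem ae_eq_const_of_integral_mul_deriv_eq_zero {a b : ℝ} (hab : a < b) {D : ℝ → ℝ}
    (hD : IntegrableOn D (Ioo a b))
    (h : ∀ β, IsTest (Ioo a b) β → ∫ t in Ioo a b, D t * deriv β t = 0) :
    ∃ C, ∀ᵐ t ∂volume.restrict (Ioo a b), D t = C := by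
  obtain ⟨η, hη, hη1⟩ := IsTest.exists_integral_eq_one hab
  have hi : ∀ φ, IsTest (Ioo a b) φ → IntegrableOn (fun t => D t * φ t) (Ioo a b) := by
    intro φ hφ
    obtain ⟨c, hc⟩ := hφ.hasCompactSupport.exists_bound_of_continuous hφ.continuous
    exact hD.mul_bdd hφ.continuous.aestronglyMeasurable (ae_of_all _ hc)
  refine ⟨∫ t in Ioo a b, D t * η t, ?_⟩
  set C := ∫ t in Ioo a b, D t * η t with hC
  have key := isOpen_Ioo.ae_eq_zero_of_integral_contDiff_smul_eq_zero (μ := volume) (U := Ioo a b)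
    (f := fun t => D t - C)
    (hD.locallyIntegrableOn.sub ((locallyIntegrable_const C).locallyIntegrableOn _)) (by
      intro φ h1 h2 h3
      have hφ : IsTest (Ioo a b) φ := ⟨h1, h2, h3⟩
      have hφi : Integrable φ := hφ.continuous.integrable_of_hasCompactSupport h2
      have hηi : Integrable η := hη.continuous.integrable_of_hasCompactSupport hη.2
      obtain ⟨β, hβ, hβd⟩ := (hφ.sub_smul hη (∫ t, φ t)).exists_primitive (by
        rw [integral_sub hφi (hηi.const_mul _), integral_const_mul, hη1]
        ring)
      have e := h β hβ
      rw [hβd] at e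
      simp only [mul_sub, mul_left_comm (D _)] at e
      rw [integral_sub (hi φ hφ) ((hi η hη).const_mul _), integral_const_mul, ← hC] at e
      simp only [smul_eq_mul, mul_comm (φ _)]
      rw [← hφ.setIntegral_eq]
      simp only [sub_mul]
      rw [integral_sub (hi φ hφ) (hφi.integrableOn.const_mul _), integral_const_mul]
      have := hφ.setIntegral_eq (fun _ => 1)
      simp only [one_mul] at this
      rw [this]
      linarith)
  rw [ae_restrict_iff' measurableSet_Ioo]
  filter_upwards [key] with t ht htm
  linarith [ht htm]

/-- A weakly differentiable function on an interval is a primitive of its weak derivative. -/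
theorem ae_eq_primitive_of_weak_deriv {a b : ℝ} (hab : a < b) {V G : ℝ → ℝ}
    (hV : IntegrableOn V (Ioo a b)) (hG : IntegrableOn G (Ioo a b))
    (h : ∀ β, IsTest (Ioo a b) β →
      ∫ t in Ioo a b, V t * deriv β t = -∫ t in Ioo a b, G t * β t) :
    ∃ C, ∀ᵐ t ∂volume.restrict (Ioo a b), V t = C + ∫ r in a..t, G r := by
  have hGi : IntervalIntegrable G volume a b :=
    (intervalIntegrable_iff_integrableOn_Ioo_of_le hab.le).2 hG
  have hPc : ContinuousOn (fun t => ∫ r in a..t, G r) (Icc a b) := by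
    have := intervalIntegral.continuousOn_primitive_interval' hGi left_mem_uIcc
    rwa [uIcc_of_le hab.le] at this
  have hP : IntegrableOn (fun t => ∫ r in a..t, G r) (Ioo a b) :=
    (hPc.integrableOn_compact isCompact_Icc).mono_set Ioo_subset_Icc_self
  obtain ⟨C, hC⟩ := ae_eq_const_of_integral_mul_deriv_eq_zero hab
    (D := fun t => V t - ∫ r in a..t, G r)
    (hV.sub hP) (by
      intro β hβ
      have e := integral_mul_eq_of_primitive (a := a) (b := b) (p := fun t => ∫ r in a..t, G r)
        (p₁ := G) (q := β) (q₁ := deriv β) hGi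
        (hβ.continuous_deriv.intervalIntegrable _ _) (fun x => by simp)
        (eq_add_integral_of_hasDerivAt hβ.hasDerivAt hβ.continuous_deriv a)
      rw [hβ.eq_zero (x := a) (by simp), hβ.eq_zero (x := b) (by simp)] at e
      have hb : ∀ {g : ℝ → ℝ}, IntegrableOn g (Ioo a b) →
          IntegrableOn (fun t => g t * deriv β t) (Ioo a b) := by
        intro g hg
        obtain ⟨c, hc⟩ := hβ.hasCompactSupport.deriv.exists_bound_of_continuous hβ.continuous_deriv
        exact hg.mul_bdd hβ.continuous_deriv.aestronglyMeasurable (ae_of_all _ hc)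
      simp only [sub_mul]
      rw [integral_sub (hb hV) (hb hP), h β hβ, setIntegral_Ioo_eq_intervalIntegral hab.le,
        setIntegral_Ioo_eq_intervalIntegral hab.le, e]
      ring)
  refine ⟨C, ?_⟩
  filter_upwards [hC] with t ht
  linarith

/-- Integration by parts in one variable for a weakly differentiable `V` and a primitive `β`. The
boundary terms vanish either because `β` does or because `V` does. -/
theorem integral_mul_eq_neg_of_weak_deriv {a b : ℝ} (hab : a < b) {V G : ℝ → ℝ}
    (hV : IntegrableOn V (Ioo a b)) (hG : IntegrableOn G (Ioo a b))
    (h : ∀ β, IsTest (Ioo a b) β →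
      ∫ t in Ioo a b, V t * deriv β t = -∫ t in Ioo a b, G t * β t)
    {β β₁ : ℝ → ℝ} (hβ₁ : IntegrableOn β₁ (Ioo a b)) (hβ : ∀ x, β x = β a + ∫ t in a..x, β₁ t)
    (h0 : (β a = 0 ∧ β b = 0) ∨ ∃ V₀ : ℝ → ℝ, ContinuousOn V₀ (Icc a b) ∧ V₀ a = 0 ∧ V₀ b = 0 ∧
      V =ᵐ[volume.restrict (Ioo a b)] V₀) :
    ∫ t in Ioo a b, V t * β₁ t = -∫ t in Ioo a b, G t * β t := by
  obtain ⟨C, hC⟩ := ae_eq_primitive_of_weak_deriv hab hV hG h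
  have hGi : IntervalIntegrable G volume a b :=
    (intervalIntegrable_iff_integrableOn_Ioo_of_le hab.le).2 hG
  have hβi : IntervalIntegrable β₁ volume a b :=
    (intervalIntegrable_iff_integrableOn_Ioo_of_le hab.le).2 hβ₁
  have hPc : ContinuousOn (fun t => C + ∫ r in a..t, G r) (Icc a b) := by
    have := intervalIntegral.continuousOn_primitive_interval' hGi left_mem_uIcc
    rw [uIcc_of_le hab.le] at this
    exact continuousOn_const.add this
  have e := integral_mul_eq_of_primitive (a := a) (b := b) (p := fun t => C + ∫ r in a..t, G r)
    (p₁ := G) (q := β) (q₁ := β₁) hGi hβi (fun x => by simp) hβ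
  rw [integral_congr_ae (g := fun t => (C + ∫ r in a..t, G r) * β₁ t)
    (by filter_upwards [hC] with t ht; rw [ht]),
    setIntegral_Ioo_eq_intervalIntegral hab.le, setIntegral_Ioo_eq_intervalIntegral hab.le, e]
  rcases h0 with ⟨ha, hb⟩ | ⟨V₀, hV₀, ha, hb, hVV⟩
  · rw [ha, hb]; ring
  · have heq : EqOn (fun t => C + ∫ r in a..t, G r) V₀ (Icc a b) := by
      refine Measure.eqOn_Icc_of_ae_eq volume hab.ne ?_ hPc hV₀
      rw [← restrict_Ioo_eq_restrict_Icc]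
      filter_upwards [hC, hVV] with t h1 h2
      rw [← h1, h2]
    have h1 := heq (left_mem_Icc.2 hab.le)
    have h2 := heq (right_mem_Icc.2 hab.le)
    simp only [ha, hb] at h1 h2
    rw [h1, h2]; ring

/-! ### Weak derivatives on a rectangle -/

/-- Lebesgue measure on the open rectangle `(a, b) × (c, d)`, as a product. -/
noncomputable abbrev rectMeasure (a b c d : ℝ) : Measure (ℝ × ℝ) :=
  (volume.restrict (Ioo a b)).prod (volume.restrict (Ioo c d))

/-- `g` is the weak derivative of `v` in the first variable on `(a, b) × (c, d)`, tested against
products of test functions in one variable. -/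
def TensorWeakDeriv (a b c d : ℝ) (v g : ℝ × ℝ → ℝ) : Prop :=
  ∀ β κ : ℝ → ℝ, IsTest (Ioo a b) β → IsTest (Ioo c d) κ →
    ∫ p, v p * (deriv β p.1 * κ p.2) ∂rectMeasure a b c d =
      -∫ p, g p * (β p.1 * κ p.2) ∂rectMeasure a b c d

section

variable {a b c d : ℝ}

theorem exists_ae_norm_snd_le {k : ℝ → ℝ} (hk : Continuous k) (a b c d : ℝ) :
    ∃ C, ∀ᵐ p ∂rectMeasure a b c d, ‖k p.2‖ ≤ C := by
  obtain ⟨C, hC⟩ := (isCompact_Icc (a := c) (b := d)).exists_bound_of_continuousOn hk.continuousOn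
  refine ⟨C, ?_⟩
  rw [rectMeasure, Measure.prod_restrict]
  filter_upwards [ae_restrict_mem (measurableSet_Ioo.prod measurableSet_Ioo)] with p hp
  exact hC _ (Ioo_subset_Icc_self hp.2)

theorem integrable_mul_snd {F : ℝ × ℝ → ℝ} (hF : Integrable F (rectMeasure a b c d))
    {k : ℝ → ℝ} (hk : Continuous k) : Integrable (fun p => F p * k p.2) (rectMeasure a b c d) := by
  obtain ⟨C, hC⟩ := exists_ae_norm_snd_le hk a b c d
  exact hF.mul_bdd (hk.comp continuous_snd).aestronglyMeasurable hC

theorem integrable_mul_fst {v : ℝ × ℝ → ℝ} (hv : MemLp v 2 (rectMeasure a b c d)) {r : ℝ → ℝ}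
    (hr : MemLp r 2 (volume.restrict (Ioo a b))) :
    Integrable (fun p => v p * r p.1) (rectMeasure a b c d) :=
  hv.integrable_mul (hr.comp_fst (volume.restrict (Ioo c d)))

theorem integrable_mul_tensor {v : ℝ × ℝ → ℝ} (hv : MemLp v 2 (rectMeasure a b c d)) {r : ℝ → ℝ}
    (hr : MemLp r 2 (volume.restrict (Ioo a b))) {k : ℝ → ℝ} (hk : Continuous k) :
    Integrable (fun p => v p * (r p.1 * k p.2)) (rectMeasure a b c d) := by
  simpa only [mul_assoc] using integrable_mul_snd (integrable_mul_fst hv hr) hk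

theorem memLp_of_continuous {r : ℝ → ℝ} (hr : Continuous r) :
    MemLp r 2 (volume.restrict (Ioo a b)) := by
  obtain ⟨C, hC⟩ := (isCompact_Icc (a := a) (b := b)).exists_bound_of_continuousOn hr.continuousOn
  refine MemLp.of_bound hr.aestronglyMeasurable C ?_
  filter_upwards [ae_restrict_mem measurableSet_Ioo] with p hp
  exact hC _ (Ioo_subset_Icc_self hp)

/-- If `F` is orthogonal to all test functions in the second variable, then it is orthogonal to
all continuous functions of that variable. -/
theorem integral_mul_snd_eq_zero {F : ℝ × ℝ → ℝ} (hF : Integrable F (rectMeasure a b c d))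
    (h : ∀ κ, IsTest (Ioo c d) κ → ∫ p, F p * κ p.2 ∂rectMeasure a b c d = 0)
    {k : ℝ → ℝ} (hk : Continuous k) : ∫ p, F p * k p.2 ∂rectMeasure a b c d = 0 := by
  have fub : ∀ k : ℝ → ℝ, Continuous k → ∫ p, F p * k p.2 ∂rectMeasure a b c d =
      ∫ y in Ioo c d, (∫ x in Ioo a b, F (x, y)) * k y := by
    intro k hk
    rw [integral_prod_symm _ (integrable_mul_snd hF hk)]
    simp only [integral_mul_const]
  have key := isOpen_Ioo.ae_eq_zero_of_integral_contDiff_smul_eq_zero (μ := volume) (U := Ioo c d)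
    (f := fun y => ∫ x in Ioo a b, F (x, y))
    (IntegrableOn.locallyIntegrableOn hF.integral_prod_right) (by
      intro κ h1 h2 h3
      have hκ : IsTest (Ioo c d) κ := ⟨h1, h2, h3⟩
      simp only [smul_eq_mul, mul_comm (κ _)]
      rw [← hκ.setIntegral_eq, ← fub κ hκ.continuous, h κ hκ])
  rw [fub k hk]
  refine integral_eq_zero_of_ae ?_
  rw [Filter.EventuallyEq, ae_restrict_iff' measurableSet_Ioo]
  filter_upwards [key] with y hy hyJ
  simp [hy hyJ]

namespace TensorWeakDeriv

variable {v g : ℝ × ℝ → ℝ}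

/-- In the definition the factor in the second variable may be any continuous function. -/
theorem integral_test_mul (h : TensorWeakDeriv a b c d v g)
    (hv : MemLp v 2 (rectMeasure a b c d)) (hg : MemLp g 2 (rectMeasure a b c d)) {β k : ℝ → ℝ}
    (hβ : IsTest (Ioo a b) β) (hk : Continuous k) :
    ∫ p, v p * (deriv β p.1 * k p.2) ∂rectMeasure a b c d =
      -∫ p, g p * (β p.1 * k p.2) ∂rectMeasure a b c d := by
  have m1 := memLp_of_continuous (a := a) (b := b) hβ.continuous_deriv
  have m2 := memLp_of_continuous (a := a) (b := b) hβ.continuous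
  have split : ∀ k : ℝ → ℝ, Continuous k →
      ∫ p, (v p * deriv β p.1 + g p * β p.1) * k p.2 ∂rectMeasure a b c d =
      ∫ p, v p * (deriv β p.1 * k p.2) ∂rectMeasure a b c d +
      ∫ p, g p * (β p.1 * k p.2) ∂rectMeasure a b c d := by
    intro k hk
    rw [← integral_add (integrable_mul_tensor hv m1 hk) (integrable_mul_tensor hg m2 hk)]
    congr 1
    ext p
    ring
  have := integral_mul_snd_eq_zero ((integrable_mul_fst hv m1).add (integrable_mul_fst hg m2))
    (fun κ hκ => by
      have := split κ hκ.continuous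
      rw [h β κ hβ hκ, neg_add_cancel] at this
      exact this) hk
  have e := split k hk
  simp only [Pi.add_apply] at this
  rw [this] at e
  linarith

/-- Integration by parts in the first variable against `β(x) k(y)` with `β` absolutely
continuous and `k` continuous. The boundary terms vanish either because `β` does or because `v`
does. -/
theorem integral_mul (h : TensorWeakDeriv a b c d v g) (hab : a < b)
    (hv : MemLp v 2 (rectMeasure a b c d)) (hg : MemLp g 2 (rectMeasure a b c d)) {β β₁ k : ℝ → ℝ}
    (hβ₁ : MemLp β₁ 2 (volume.restrict (Ioo a b))) (hβ : ∀ x, β x = β a + ∫ t in a..x, β₁ t)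
    (hβc : Continuous β) (hk : Continuous k)
    (h0 : (β a = 0 ∧ β b = 0) ∨ ∃ V : ℝ × ℝ → ℝ, Continuous V ∧
      (∀ y ∈ Ioo c d, V (a, y) = 0 ∧ V (b, y) = 0) ∧ v =ᵐ[rectMeasure a b c d] V) :
    ∫ p, v p * (β₁ p.1 * k p.2) ∂rectMeasure a b c d =
      -∫ p, g p * (β p.1 * k p.2) ∂rectMeasure a b c d := by
  have fub : ∀ {v : ℝ × ℝ → ℝ} {r : ℝ → ℝ}, MemLp v 2 (rectMeasure a b c d) →
      MemLp r 2 (volume.restrict (Ioo a b)) →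
      ∫ p, v p * (r p.1 * k p.2) ∂rectMeasure a b c d =
        ∫ x in Ioo a b, (∫ y in Ioo c d, v (x, y) * k y) * r x := by
    intro v r hv hr
    rw [integral_prod _ (integrable_mul_tensor hv hr hk)]
    congr 1
    ext x
    rw [← integral_mul_const]
    congr 1
    ext y
    ring
  have hVi : ∀ {v : ℝ × ℝ → ℝ}, MemLp v 2 (rectMeasure a b c d) →
      IntegrableOn (fun x => ∫ y in Ioo c d, v (x, y) * k y) (Ioo a b) := fun hv =>
    (integrable_mul_snd (hv.integrable one_le_two) hk).integral_prod_left
  rw [fub hv hβ₁, fub hg (memLp_of_continuous hβc)]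
  refine integral_mul_eq_neg_of_weak_deriv hab (hVi hv) (hVi hg) (fun φ hφ => ?_)
    (hβ₁.integrable one_le_two) hβ ?_
  · rw [← fub hv (memLp_of_continuous hφ.continuous_deriv),
      ← fub hg (memLp_of_continuous hφ.continuous)]
    exact h.integral_test_mul hv hg hφ hk
  · rcases h0 with h0 | ⟨V, hV, hV0, hvV⟩
    · exact Or.inl h0
    refine Or.inr ⟨fun x => ∫ y in Ioo c d, V (x, y) * k y, ?_, ?_, ?_, ?_⟩
    · refine Continuous.continuousOn ?_
      rcases le_or_gt d c with hcd | hcd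
      · simp [Ioo_eq_empty (not_lt.2 hcd), continuous_const]
      simp only [setIntegral_Ioo_eq_intervalIntegral hcd.le]
      exact intervalIntegral.continuous_parametric_intervalIntegral_of_continuous'
        (f := fun x y => V (x, y) * k y) (by fun_prop) c d
    · exact setIntegral_eq_zero_of_forall_eq_zero fun y hy => by rw [(hV0 y hy).1, zero_mul]
    · exact setIntegral_eq_zero_of_forall_eq_zero fun y hy => by rw [(hV0 y hy).2, zero_mul]
    · filter_upwards [Measure.ae_ae_of_ae_prod hvV] with x hx
      exact integral_congr_ae (by filter_upwards [hx] with y hy; rw [hy])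

end TensorWeakDeriv

theorem hasFDerivAt_tensor {β β₁ κ κ₁ : ℝ → ℝ} (hβ : ∀ t, HasDerivAt β (β₁ t) t)
    (hκ : ∀ t, HasDerivAt κ (κ₁ t) t) (p : ℝ × ℝ) :
    HasFDerivAt (fun p : ℝ × ℝ => β p.1 * κ p.2)
      (β p.1 • (κ₁ p.2 • ContinuousLinearMap.snd ℝ ℝ ℝ) +
        κ p.2 • (β₁ p.1 • ContinuousLinearMap.fst ℝ ℝ ℝ)) p :=
  HasFDerivAt.mul ((hβ p.1).comp_hasFDerivAt p hasFDerivAt_fst)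
    ((hκ p.2).comp_hasFDerivAt p hasFDerivAt_snd)

theorem IsTest.tensor {I J : Set ℝ} {β κ : ℝ → ℝ} (hβ : IsTest I β) (hκ : IsTest J κ) :
    ContDiff ℝ ∞ (fun p : ℝ × ℝ => β p.1 * κ p.2) ∧
      HasCompactSupport (fun p : ℝ × ℝ => β p.1 * κ p.2) ∧
      tsupport (fun p : ℝ × ℝ => β p.1 * κ p.2) ⊆ I ×ˢ J := by
  have hs : tsupport (fun p : ℝ × ℝ => β p.1 * κ p.2) ⊆ tsupport β ×ˢ tsupport κ := by
    refine closure_minimal (fun p hp => ?_)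
      ((isClosed_tsupport β).prod (isClosed_tsupport κ))
    have := mul_ne_zero_iff.1 hp
    exact ⟨subset_tsupport _ this.1, subset_tsupport _ this.2⟩
  exact ⟨(hβ.contDiff.comp contDiff_fst).mul (hκ.contDiff.comp contDiff_snd),
    (hβ.hasCompactSupport.isCompact.prod hκ.hasCompactSupport.isCompact).of_isClosed_subset
      (isClosed_tsupport _) hs,
    hs.trans (prod_mono hβ.tsupport_subset hκ.tsupport_subset)⟩

theorem volume_restrict_prod (a b c d : ℝ) :
    (volume : Measure (ℝ × ℝ)).restrict (Ioo a b ×ˢ Ioo c d) = rectMeasure a b c d := by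
  rw [rectMeasure, Measure.prod_restrict, Measure.volume_eq_prod]

theorem HasWeakDeriv.tensor_fst {v g : ℝ × ℝ → ℝ}
    (h : HasWeakDeriv (Ioo a b ×ˢ Ioo c d) (1, 0) v g) : TensorWeakDeriv a b c d v g := by
  intro β κ hβ hκ
  obtain ⟨h1, h2, h3⟩ := hβ.tensor hκ
  have := h.2.2 _ h1 h2 h3
  rw [volume_restrict_prod] at this
  rw [← this]
  congr 1
  ext p
  rw [(hasFDerivAt_tensor hβ.hasDerivAt hκ.hasDerivAt p).fderiv]
  simp [mul_comm]

theorem integral_rectMeasure_swap (F : ℝ × ℝ → ℝ) :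
    ∫ p, F p.swap ∂rectMeasure c d a b = ∫ p, F p ∂rectMeasure a b c d :=
  integral_prod_swap F

theorem HasWeakDeriv.tensor_snd {v g : ℝ × ℝ → ℝ}
    (h : HasWeakDeriv (Ioo a b ×ˢ Ioo c d) (0, 1) v g) :
    TensorWeakDeriv c d a b (fun p => v p.swap) (fun p => g p.swap) := by
  intro κ β hκ hβ
  obtain ⟨h1, h2, h3⟩ := hβ.tensor hκ
  have := h.2.2 _ h1 h2 h3
  rw [volume_restrict_prod,
    ← integral_rectMeasure_swap (fun p => v p * fderiv ℝ (fun p : ℝ × ℝ => β p.1 * κ p.2) p (0, 1)),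
    ← integral_rectMeasure_swap (fun p => g p * (β p.1 * κ p.2))] at this
  simp only [(hasFDerivAt_tensor hβ.hasDerivAt hκ.hasDerivAt _).fderiv] at this
  simpa [mul_comm] using this

end

/-! ### Sobolev functions on the plate -/

theorem integrableOn_mul_of_tsupport_subset {E : Type*} [NormedAddCommGroup E]
    [MeasureSpace E] [BorelSpace E] {U : Set E} {g φ : E → ℝ}
    (hg : LocallyIntegrableOn g U) (hφ : Continuous φ) (hc : HasCompactSupport φ)
    (hs : tsupport φ ⊆ U) : IntegrableOn (fun x => g x * φ x) U := by
  have h0 : IntegrableOn (fun x => g x * φ x) (tsupport φ) :=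
    (hg.integrableOn_compact_subset hs hc).mul_continuousOn hφ.continuousOn hc
  refine ((integrableOn_iff_integrable_of_support_subset ?_).1 h0).integrableOn
  intro x hx
  exact subset_tsupport φ (fun h => hx (by simp [h]))

section

variable {E : Type*} [NormedAddCommGroup E] [NormedSpace ℝ E] [MeasureSpace E]
  {U : Set E} {e : E} {u v g k : E → ℝ}

theorem HasWeakDeriv.sub [BorelSpace E] (hu : HasWeakDeriv U e u g) (hv : HasWeakDeriv U e v k) :
    HasWeakDeriv U e (u - v) (g - k) := by
  refine ⟨hu.1.sub hv.1, hu.2.1.sub hv.2.1, fun φ h1 h2 h3 => ?_⟩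
  have hdc : Continuous fun x => fderiv ℝ φ x e :=
    (h1.continuous_fderiv (by simp)).clm_apply continuous_const
  have hds := (tsupport_fderiv_apply_subset ℝ e (f := φ)).trans h3
  have hdk : HasCompactSupport fun x => fderiv ℝ φ x e := h2.fderiv_apply ℝ e
  simp only [Pi.sub_apply, sub_mul]
  rw [integral_sub (integrableOn_mul_of_tsupport_subset hu.1 hdc hdk hds)
      (integrableOn_mul_of_tsupport_subset hv.1 hdc hdk hds),
    integral_sub (integrableOn_mul_of_tsupport_subset hu.2.1 h1.continuous h2 h3)
      (integrableOn_mul_of_tsupport_subset hv.2.1 h1.continuous h2 h3),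
    hu.2.2 φ h1 h2 h3, hv.2.2 φ h1 h2 h3]
  ring

theorem HasWeakDeriv.congr_left (h : HasWeakDeriv U e u g) (huv : u =ᵐ[volume.restrict U] v)
    (hv : LocallyIntegrableOn v U) : HasWeakDeriv U e v g := by
  refine ⟨hv, h.2.1, fun φ h1 h2 h3 => ?_⟩
  rw [← h.2.2 φ h1 h2 h3]
  exact integral_congr_ae (by filter_upwards [huv] with x hx; rw [hx])

theorem MemH.sub [BorelSpace E] {n : ℕ} {u v : E → ℝ} (hu : MemH U n u) (hv : MemH U n v) :
    MemH U n (u - v) := by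
  induction n generalizing u v with
  | zero => exact MemLp.sub hu hv
  | succ n ih =>
    refine ⟨hu.1.sub hv.1, fun e => ?_⟩
    obtain ⟨g, hg, hg'⟩ := hu.2 e
    obtain ⟨k, hk, hk'⟩ := hv.2 e
    exact ⟨g - k, hg.sub hk, ih hg' hk'⟩

variable [FiniteDimensional ℝ E] [BorelSpace E] [(volume : Measure E).IsAddHaarMeasure]

theorem hasWeakDeriv_of_contDiff (hu : ContDiff ℝ 1 u) :
    HasWeakDeriv U e u (fun x => fderiv ℝ u x e) := by
  have hdu : Continuous fun x => fderiv ℝ u x e :=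
    (hu.continuous_fderiv (by simp)).clm_apply continuous_const
  refine ⟨hu.continuous.locallyIntegrable.locallyIntegrableOn _,
    hdu.locallyIntegrable.locallyIntegrableOn _, fun φ h1 h2 h3 => ?_⟩
  have hdc : Continuous fun x => fderiv ℝ φ x e :=
    (h1.continuous_fderiv (by simp)).clm_apply continuous_const
  have hdk : HasCompactSupport fun x => fderiv ℝ φ x e := h2.fderiv_apply ℝ e
  have hds := (tsupport_fderiv_apply_subset ℝ e (f := φ)).trans h3
  rw [setIntegral_eq_integral_of_forall_compl_eq_zero
      (fun x hx => by rw [image_eq_zero_of_notMem_tsupport (fun h => hx (hds h)), mul_zero]),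
    setIntegral_eq_integral_of_forall_compl_eq_zero
      (fun x hx => by rw [image_eq_zero_of_notMem_tsupport (fun h => hx (h3 h)), mul_zero])]
  exact integral_mul_fderiv_eq_neg_fderiv_mul_of_integrable
    ((hdu.mul h1.continuous).integrable_of_hasCompactSupport h2.mul_left)
    ((hu.continuous.mul hdc).integrable_of_hasCompactSupport hdk.mul_left)
    ((hu.continuous.mul h1.continuous).integrable_of_hasCompactSupport h2.mul_left)
    (fun x _ => hu.differentiable (by simp) x) (fun x _ => h1.differentiable (by simp) x)

theorem memLp_restrict_of_continuous (hU : Bornology.IsBounded U) (hUm : MeasurableSet U)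
    (hu : Continuous u) : MemLp u 2 (volume.restrict U) := by
  have hK : IsCompact (closure U) := hU.isCompact_closure
  obtain ⟨C, hC⟩ := hK.exists_bound_of_continuousOn hu.continuousOn
  have : IsFiniteMeasure ((volume : Measure E).restrict U) :=
    ⟨by simpa using hU.measure_lt_top⟩
  refine MemLp.of_bound hu.aestronglyMeasurable C ?_
  filter_upwards [ae_restrict_mem hUm] with p hp
  exact hC _ (subset_closure hp)

theorem memH_of_contDiff (hU : Bornology.IsBounded U) (hUm : MeasurableSet U) (n : ℕ) {u : E → ℝ}
    (hu : ContDiff ℝ n u) : MemH U n u := by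
  induction n generalizing u with
  | zero => exact memLp_restrict_of_continuous hU hUm hu.continuous
  | succ n ih =>
    refine ⟨memLp_restrict_of_continuous hU hUm hu.continuous, fun e => ⟨_,
      hasWeakDeriv_of_contDiff (hu.of_le (by norm_cast; omega)), ih ?_⟩⟩
    exact (hu.fderiv_right (by norm_cast)).clm_apply contDiff_const

end

theorem isOpen_plate (ℓ : ℝ) : IsOpen (plate ℓ) := isOpen_Ioo.prod isOpen_Ioo

theorem isBounded_plate (ℓ : ℝ) : Bornology.IsBounded (plate ℓ) :=
  (Metric.isBounded_Ioo _ _).prod (Metric.isBounded_Ioo _ _)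

theorem volume_restrict_plate (ℓ : ℝ) :
    (volume : Measure (ℝ × ℝ)).restrict (plate ℓ) = rectMeasure 0 Real.pi (-ℓ) ℓ :=
  volume_restrict_prod _ _ _ _

/-- The square integrable weak derivatives of first and second order of `u` on the plate. The
mixed derivative is the derivative in `y` of the derivative in `x`. -/
structure H2Deriv (ℓ : ℝ) (u ux uy uxx uxy uyy : ℝ × ℝ → ℝ) : Prop where
  x : HasWeakDeriv (plate ℓ) (1, 0) u ux
  y : HasWeakDeriv (plate ℓ) (0, 1) u uy
  xx : HasWeakDeriv (plate ℓ) (1, 0) ux uxx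
  xy : HasWeakDeriv (plate ℓ) (0, 1) ux uxy
  yy : HasWeakDeriv (plate ℓ) (0, 1) uy uyy
  memLp : MemLp u 2 (volume.restrict (plate ℓ))
  memLp_x : MemLp ux 2 (volume.restrict (plate ℓ))
  memLp_y : MemLp uy 2 (volume.restrict (plate ℓ))
  memLp_xx : MemLp uxx 2 (volume.restrict (plate ℓ))
  memLp_xy : MemLp uxy 2 (volume.restrict (plate ℓ))
  memLp_yy : MemLp uyy 2 (volume.restrict (plate ℓ))

theorem MemH.exists_h2Deriv {ℓ : ℝ} {u : ℝ × ℝ → ℝ} (h : MemH (plate ℓ) 2 u) :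
    ∃ ux uy uxx uxy uyy, H2Deriv ℓ u ux uy uxx uxy uyy := by
  obtain ⟨ux, hx, hx'⟩ := h.2 (1, 0)
  obtain ⟨uy, hy, hy'⟩ := h.2 (0, 1)
  obtain ⟨uxx, hxx, hxx'⟩ := hx'.2 (1, 0)
  obtain ⟨uxy, hxy, hxy'⟩ := hx'.2 (0, 1)
  obtain ⟨uyy, hyy, hyy'⟩ := hy'.2 (0, 1)
  exact ⟨ux, uy, uxx, uxy, uyy, hx, hy, hxx, hxy, hyy, h.1, hx'.1, hy'.1, hxx', hxy', hyy'⟩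

namespace H2Deriv

variable {ℓ : ℝ} {u ux uy uxx uxy uyy v vx vy vxx vxy vyy : ℝ × ℝ → ℝ}

theorem sub (hu : H2Deriv ℓ u ux uy uxx uxy uyy) (hv : H2Deriv ℓ v vx vy vxx vxy vyy) :
    H2Deriv ℓ (u - v) (ux - vx) (uy - vy) (uxx - vxx) (uxy - vxy) (uyy - vyy) where
  x := hu.x.sub hv.x
  y := hu.y.sub hv.y
  xx := hu.xx.sub hv.xx
  xy := hu.xy.sub hv.xy
  yy := hu.yy.sub hv.yy
  memLp := hu.memLp.sub hv.memLp
  memLp_x := hu.memLp_x.sub hv.memLp_x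
  memLp_y := hu.memLp_y.sub hv.memLp_y
  memLp_xx := hu.memLp_xx.sub hv.memLp_xx
  memLp_xy := hu.memLp_xy.sub hv.memLp_xy
  memLp_yy := hu.memLp_yy.sub hv.memLp_yy

theorem weakDeriv_weakDeriv_ae_eq {e e' : ℝ × ℝ} {u g k : ℝ × ℝ → ℝ}
    (h : HasWeakDeriv (plate ℓ) e u g) (h' : HasWeakDeriv (plate ℓ) e' g k) :
    weakDeriv (plate ℓ) e' (weakDeriv (plate ℓ) e u) =ᵐ[volume.restrict (plate ℓ)] k := by
  have e1 := HasWeakDeriv.ae_eq (isOpen_plate ℓ) h h.weakDeriv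
  have e2 := h'.congr_left e1 h.weakDeriv.2.1
  exact HasWeakDeriv.ae_eq (isOpen_plate ℓ) e2.weakDeriv e2

/-- The scalar product may be computed from any choice of the weak derivatives. -/
theorem scalarProd_eq (hu : H2Deriv ℓ u ux uy uxx uxy uyy) (hv : H2Deriv ℓ v vx vy vxx vxy vyy)
    (σ : ℝ) :
    scalarProd ℓ σ u v = ∫ p in plate ℓ,
      ((uxx p + uyy p) * (vxx p + vyy p) +
        (1 - σ) * (2 * uxy p * vxy p - uxx p * vyy p - uyy p * vxx p)) := by
  refine integral_congr_ae ?_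
  filter_upwards [weakDeriv_weakDeriv_ae_eq hu.x hu.xx, weakDeriv_weakDeriv_ae_eq hu.x hu.xy,
    weakDeriv_weakDeriv_ae_eq hu.y hu.yy, weakDeriv_weakDeriv_ae_eq hv.x hv.xx,
    weakDeriv_weakDeriv_ae_eq hv.x hv.xy, weakDeriv_weakDeriv_ae_eq hv.y hv.yy]
    with p h1 h2 h3 h4 h5 h6
  simp only [dx, dy, h1, h2, h3, h4, h5, h6]

theorem integrable_energy (hu : H2Deriv ℓ u ux uy uxx uxy uyy)
    (hv : H2Deriv ℓ v vx vy vxx vxy vyy) (σ : ℝ) :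
    IntegrableOn (fun p => (uxx p + uyy p) * (vxx p + vyy p) +
        (1 - σ) * (2 * uxy p * vxy p - uxx p * vyy p - uyy p * vxx p)) (plate ℓ) := by
  refine ((hu.memLp_xx.add hu.memLp_yy).integrable_mul (hv.memLp_xx.add hv.memLp_yy)).add
    (Integrable.const_mul (((?_ : Integrable _ _).sub ?_).sub ?_) _)
  · simp only [mul_assoc]
    exact (hu.memLp_xy.integrable_mul hv.memLp_xy).const_mul 2
  · exact hu.memLp_xx.integrable_mul hv.memLp_yy
  · exact hu.memLp_yy.integrable_mul hv.memLp_xx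

end H2Deriv

theorem contDiff_one_of_hasDerivAt {β β₁ : ℝ → ℝ} (hβ : ∀ t, HasDerivAt β (β₁ t) t)
    (hβ₁ : Continuous β₁) : ContDiff ℝ 1 β := by
  rw [contDiff_one_iff_deriv]
  refine ⟨fun t => (hβ t).differentiableAt, ?_⟩
  rwa [funext fun t => (hβ t).deriv]

theorem contDiff_two_of_hasDerivAt {β β₁ β₂ : ℝ → ℝ} (hβ : ∀ t, HasDerivAt β (β₁ t) t)
    (hβ₁ : ∀ t, HasDerivAt β₁ (β₂ t) t) (hβ₂ : Continuous β₂) : ContDiff ℝ 2 β := by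
  rw [show (2 : WithTop ℕ∞) = 1 + 1 by norm_num, contDiff_succ_iff_deriv]
  refine ⟨fun t => (hβ t).differentiableAt, by simp, ?_⟩
  rw [funext fun t => (hβ t).deriv]
  exact contDiff_one_of_hasDerivAt hβ₁ hβ₂

theorem hasWeakDeriv_tensor {U : Set (ℝ × ℝ)} {β β₁ κ κ₁ : ℝ → ℝ}
    (hβ : ∀ t, HasDerivAt β (β₁ t) t) (hκ : ∀ t, HasDerivAt κ (κ₁ t) t)
    (hβ₁ : Continuous β₁) (hκ₁ : Continuous κ₁) :
    HasWeakDeriv U (1, 0) (fun p => β p.1 * κ p.2) (fun p => β₁ p.1 * κ p.2) ∧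
      HasWeakDeriv U (0, 1) (fun p => β p.1 * κ p.2) (fun p => β p.1 * κ₁ p.2) := by
  have hc : ContDiff ℝ 1 (fun p : ℝ × ℝ => β p.1 * κ p.2) :=
    ((contDiff_one_of_hasDerivAt hβ hβ₁).comp contDiff_fst).mul
      ((contDiff_one_of_hasDerivAt hκ hκ₁).comp contDiff_snd)
  constructor
  · convert hasWeakDeriv_of_contDiff hc using 1
    ext p
    rw [(hasFDerivAt_tensor hβ hκ p).fderiv]
    simp [mul_comm]
  · convert hasWeakDeriv_of_contDiff hc using 1
    ext p
    rw [(hasFDerivAt_tensor hβ hκ p).fderiv]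
    simp

theorem h2Deriv_tensor (ℓ : ℝ) {β β₁ β₂ κ κ₁ κ₂ : ℝ → ℝ}
    (hβ : ∀ t, HasDerivAt β (β₁ t) t) (hβ₁ : ∀ t, HasDerivAt β₁ (β₂ t) t) (hβ₂ : Continuous β₂)
    (hκ : ∀ t, HasDerivAt κ (κ₁ t) t) (hκ₁ : ∀ t, HasDerivAt κ₁ (κ₂ t) t) (hκ₂ : Continuous κ₂) :
    H2Deriv ℓ (fun p => β p.1 * κ p.2) (fun p => β₁ p.1 * κ p.2) (fun p => β p.1 * κ₁ p.2)
      (fun p => β₂ p.1 * κ p.2) (fun p => β₁ p.1 * κ₁ p.2) (fun p => β p.1 * κ₂ p.2) := by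
  have cc : ∀ {r r₁ : ℝ → ℝ}, (∀ t, HasDerivAt r (r₁ t) t) → Continuous r := fun h =>
    continuous_iff_continuousAt.2 fun t => (h t).continuousAt
  have c1 := cc hβ
  have c2 := cc hβ₁
  have c3 := cc hκ
  have c4 := cc hκ₁
  have mm : ∀ r : ℝ × ℝ → ℝ, Continuous r → MemLp r 2 (volume.restrict (plate ℓ)) := fun r hr =>
    memLp_restrict_of_continuous (isBounded_plate ℓ) (isOpen_plate ℓ).measurableSet hr
  exact ⟨(hasWeakDeriv_tensor hβ hκ c2 c4).1, (hasWeakDeriv_tensor hβ hκ c2 c4).2,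
    (hasWeakDeriv_tensor hβ₁ hκ hβ₂ c4).1, (hasWeakDeriv_tensor hβ₁ hκ hβ₂ c4).2,
    (hasWeakDeriv_tensor hβ hκ₁ c2 hκ₂).2, mm _ (by fun_prop), mm _ (by fun_prop),
    mm _ (by fun_prop), mm _ (by fun_prop), mm _ (by fun_prop), mm _ (by fun_prop)⟩

/-! ### Integration by parts on the plate -/

variable {ℓ : ℝ}

/-- The boundary condition of `H²_*(Ω)` for a continuous representative defined on the whole
plane. -/
theorem MemH2Star.exists_continuous (hℓ : 0 < ℓ) {u : ℝ × ℝ → ℝ} (h : MemH2Star ℓ u) :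
    ∃ V : ℝ × ℝ → ℝ, Continuous V ∧
      (∀ y ∈ Ioo (-ℓ) ℓ, V (0, y) = 0 ∧ V (Real.pi, y) = 0) ∧
      u =ᵐ[volume.restrict (plate ℓ)] V := by
  obtain ⟨-, U, hU, huU, hU0⟩ := h
  have hπ := Real.pi_pos.le
  have hl : -ℓ ≤ ℓ := by linarith
  rw [plate, closure_prod_eq, closure_Ioo Real.pi_pos.ne, closure_Ioo (by linarith)] at hU
  have hcl : ∀ {a b t : ℝ}, a ≤ b → t ∈ Icc a b → max a (min b t) = t := fun _ ht => by
    rw [min_eq_right ht.2, max_eq_right ht.1]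
  refine ⟨fun p => U (max 0 (min Real.pi p.1), max (-ℓ) (min ℓ p.2)), ?_, fun y hy => ?_, ?_⟩
  · exact hU.comp_continuous (by fun_prop) fun p =>
      ⟨⟨le_max_left _ _, max_le hπ (min_le_left _ _)⟩,
        ⟨le_max_left _ _, max_le hl (min_le_left _ _)⟩⟩
  · simp only
    rw [hcl hπ (left_mem_Icc.2 hπ), hcl hπ (right_mem_Icc.2 hπ), hcl hl (Ioo_subset_Icc_self hy)]
    exact hU0 y hy
  · filter_upwards [huU, ae_restrict_mem (isOpen_plate ℓ).measurableSet] with p hp hpm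
    rw [hcl hπ (Ioo_subset_Icc_self hpm.1), hcl hl (Ioo_subset_Icc_self hpm.2)]
    exact hp

theorem memLp_swap {a b c d : ℝ} {v : ℝ × ℝ → ℝ} (hv : MemLp v 2 (rectMeasure a b c d)) :
    MemLp (fun p => v p.swap) 2 (rectMeasure c d a b) :=
  hv.comp_measurePreserving Measure.measurePreserving_swap

namespace H2Deriv

variable {v vx vy vxx vxy vyy : ℝ × ℝ → ℝ}

/-- Two integrations by parts in `x` for a function that vanishes on the hinged sides. -/
theorem integral_xx (hv : H2Deriv ℓ v vx vy vxx vxy vyy) {V : ℝ × ℝ → ℝ} (hV : Continuous V)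
    (hV0 : ∀ y ∈ Ioo (-ℓ) ℓ, V (0, y) = 0 ∧ V (Real.pi, y) = 0)
    (hvV : v =ᵐ[volume.restrict (plate ℓ)] V) {β β₁ β₂ k : ℝ → ℝ}
    (hβ : ∀ t, HasDerivAt β (β₁ t) t) (hβ₁ : ∀ t, HasDerivAt β₁ (β₂ t) t) (hβ₂ : Continuous β₂)
    (h0 : β 0 = 0) (hπ : β Real.pi = 0) (hk : Continuous k) :
    ∫ p in plate ℓ, vxx p * (β p.1 * k p.2) = ∫ p in plate ℓ, v p * (β₂ p.1 * k p.2) := by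
  have cβ : Continuous β := continuous_iff_continuousAt.2 fun t => (hβ t).continuousAt
  have cβ₁ : Continuous β₁ := continuous_iff_continuousAt.2 fun t => (hβ₁ t).continuousAt
  have m := hv.memLp
  have mx := hv.memLp_x
  have mxx := hv.memLp_xx
  rw [volume_restrict_plate] at hvV m mx mxx ⊢
  have e1 := hv.xx.tensor_fst.integral_mul Real.pi_pos mx mxx (memLp_of_continuous cβ₁)
    (eq_add_integral_of_hasDerivAt hβ cβ₁ 0) cβ hk (Or.inl ⟨h0, hπ⟩)
  have e2 := hv.x.tensor_fst.integral_mul Real.pi_pos m mx (memLp_of_continuous hβ₂)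
    (eq_add_integral_of_hasDerivAt hβ₁ hβ₂ 0) cβ₁ hk (Or.inr ⟨V, hV, hV0, hvV⟩)
  linarith

/-- Integration by parts in `y` against `β(x) κ(y)` with `κ` absolutely continuous and vanishing at
`±ℓ`. -/
theorem integral_y {v vy : ℝ × ℝ → ℝ} (h : HasWeakDeriv (plate ℓ) (0, 1) v vy) (hℓ : 0 < ℓ)
    (m : MemLp v 2 (volume.restrict (plate ℓ))) (my : MemLp vy 2 (volume.restrict (plate ℓ)))
    {β κ κ₁ : ℝ → ℝ} (hβ : Continuous β)
    (hκ₁ : MemLp κ₁ 2 (volume.restrict (Ioo (-ℓ) ℓ)))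
    (hκ : ∀ x, κ x = κ (-ℓ) + ∫ t in (-ℓ)..x, κ₁ t) (hκc : Continuous κ)
    (h0 : κ (-ℓ) = 0) (h1 : κ ℓ = 0) :
    ∫ p in plate ℓ, vy p * (β p.1 * κ p.2) = -∫ p in plate ℓ, v p * (β p.1 * κ₁ p.2) := by
  rw [volume_restrict_plate] at m my ⊢
  have e := h.tensor_snd.integral_mul (by linarith) (memLp_swap m) (memLp_swap my) hκ₁ hκ hκc hβ
    (Or.inl ⟨h0, h1⟩)
  rw [← integral_rectMeasure_swap (fun p => vy p * (β p.1 * κ p.2)),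
    ← integral_rectMeasure_swap (fun p => v p * (β p.1 * κ₁ p.2))]
  simp only [mul_comm _ (β _)] at e
  simp only [Prod.fst_swap, Prod.snd_swap]
  linarith

/-- The mixed derivative tested against `β₁(x) k(y)`, where neither factor need vanish on the
boundary: the order of the derivatives is exchanged for test functions of `y` first. -/
theorem integral_xy (hv : H2Deriv ℓ v vx vy vxx vxy vyy) (hℓ : 0 < ℓ) {V : ℝ × ℝ → ℝ}
    (hV : Continuous V) (hV0 : ∀ y ∈ Ioo (-ℓ) ℓ, V (0, y) = 0 ∧ V (Real.pi, y) = 0)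
    (hvV : v =ᵐ[volume.restrict (plate ℓ)] V) {β₁ β₂ k : ℝ → ℝ}
    (hβ₁ : ∀ t, HasDerivAt β₁ (β₂ t) t) (hβ₂ : Continuous β₂) (hk : Continuous k) :
    ∫ p in plate ℓ, vxy p * (β₁ p.1 * k p.2) = -∫ p in plate ℓ, vy p * (β₂ p.1 * k p.2) := by
  have cβ₁ : Continuous β₁ := continuous_iff_continuousAt.2 fun t => (hβ₁ t).continuousAt
  have m := hv.memLp
  have mx := hv.memLp_x
  have my := hv.memLp_y
  have mxy := hv.memLp_xy
  rw [volume_restrict_plate] at hvV m mx my mxy ⊢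
  have i1 := integrable_mul_fst mxy (memLp_of_continuous cβ₁)
  have i2 := integrable_mul_fst my (memLp_of_continuous hβ₂)
  have test : ∀ κ, IsTest (Ioo (-ℓ) ℓ) κ →
      ∫ p, (vxy p * β₁ p.1 + vy p * β₂ p.1) * κ p.2 ∂rectMeasure 0 Real.pi (-ℓ) ℓ = 0 := by
    intro κ hκ
    have b0 : κ (-ℓ) = 0 ∧ κ ℓ = 0 := ⟨hκ.eq_zero (by simp), hκ.eq_zero (by simp)⟩
    have e1 := integral_y hv.xy hℓ hv.memLp_x hv.memLp_xy cβ₁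
      (memLp_of_continuous hκ.continuous_deriv)
      (eq_add_integral_of_hasDerivAt hκ.hasDerivAt hκ.continuous_deriv (-ℓ)) hκ.continuous b0.1 b0.2
    have e2 := integral_y hv.y hℓ hv.memLp hv.memLp_y hβ₂
      (memLp_of_continuous hκ.continuous_deriv)
      (eq_add_integral_of_hasDerivAt hκ.hasDerivAt hκ.continuous_deriv (-ℓ)) hκ.continuous b0.1 b0.2
    rw [volume_restrict_plate] at e1 e2
    have e3 := hv.x.tensor_fst.integral_mul Real.pi_pos m mx (memLp_of_continuous hβ₂)
      (eq_add_integral_of_hasDerivAt hβ₁ hβ₂ 0) cβ₁ hκ.continuous_deriv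
      (Or.inr ⟨V, hV, hV0, hvV⟩)
    simp only [add_mul, mul_assoc]
    rw [integral_add]
    · linarith
    · simpa only [mul_assoc] using integrable_mul_snd i1 hκ.continuous
    · simpa only [mul_assoc] using integrable_mul_snd i2 hκ.continuous
  have := integral_mul_snd_eq_zero (i1.add i2) test hk
  simp only [Pi.add_apply, add_mul, mul_assoc] at this
  rw [integral_add] at this
  · linarith
  · simpa only [mul_assoc] using integrable_mul_snd i1 hk
  · simpa only [mul_assoc] using integrable_mul_snd i2 hk

end H2Deriv

theorem memH2Star_tensor {β κ : ℝ → ℝ} (hβ : ContDiff ℝ 2 β) (hκ : ContDiff ℝ 2 κ)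
    (h0 : β 0 = 0) (hπ : β Real.pi = 0) : MemH2Star ℓ (fun p => β p.1 * κ p.2) := by
  have hc : ContDiff ℝ 2 (fun p : ℝ × ℝ => β p.1 * κ p.2) :=
    (hβ.comp contDiff_fst).mul (hκ.comp contDiff_snd)
  exact ⟨memH_of_contDiff (isBounded_plate ℓ) (isOpen_plate ℓ).measurableSet 2 hc, _,
    hc.continuous.continuousOn, Filter.EventuallyEq.rfl, fun y _ => by simp [h0, hπ]⟩

/-! ### The weak solution -/

theorem hasDerivAt_sin_mul (m t : ℝ) :
    HasDerivAt (fun t => Real.sin (m * t)) (m * Real.cos (m * t)) t := by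
  simpa [mul_comm] using ((hasDerivAt_id t).const_mul m).sin

theorem hasDerivAt_mul_cos_mul (m t : ℝ) :
    HasDerivAt (fun t => m * Real.cos (m * t)) (-m ^ 2 * Real.sin (m * t)) t := by
  convert! (((hasDerivAt_id t).const_mul m).cos).const_mul m using 1
  simp
  ring

theorem ModeSystem.h2Deriv {m a : ℝ} {f w w₁ h h₁ : ℝ → ℝ} (S : ModeSystem m a f w w₁ h h₁) :
    H2Deriv ℓ (fun p => Real.sin (m * p.1) * w p.2) (fun p => m * Real.cos (m * p.1) * w p.2)
      (fun p => Real.sin (m * p.1) * w₁ p.2) (fun p => -m ^ 2 * Real.sin (m * p.1) * w p.2)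
      (fun p => m * Real.cos (m * p.1) * w₁ p.2)
      (fun p => Real.sin (m * p.1) * (m ^ 2 * w p.2 + h p.2)) :=
  have := S.continuous_w
  have := S.continuous_h
  h2Deriv_tensor ℓ (hasDerivAt_sin_mul m) (hasDerivAt_mul_cos_mul m) (by fun_prop) S.deriv_w
    S.deriv_w₁ (by fun_prop)

/-- The product of `sin (m x)` and the solution of the one-dimensional problem solves the plate
problem. -/
theorem ModeSystem.scalarProd_eq {m : ℝ} {σ : ℝ} {f w w₁ h h₁ : ℝ → ℝ} (hℓ : 0 < ℓ)
    (hm : Real.sin (m * Real.pi) = 0) (S : ModeSystem m (-ℓ) f w w₁ h h₁) (hf : Integrable f)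
    (hf2 : MemLp f 2 (volume.restrict (Ioo (-ℓ) ℓ)))
    (ha : ModeBoundary m (1 - σ) w w₁ h h₁ (-ℓ)) (hb : ModeBoundary m (1 - σ) w w₁ h h₁ ℓ)
    {v : ℝ × ℝ → ℝ} (hv : MemH2Star ℓ v) :
    scalarProd ℓ σ (fun p => Real.sin (m * p.1) * w p.2) v =
      ∫ p in plate ℓ, f p.2 * Real.sin (m * p.1) * v p := by
  obtain ⟨vx, vy, vxx, vxy, vyy, D⟩ := hv.1.exists_h2Deriv
  obtain ⟨V, hV, hV0, hvV⟩ := hv.exists_continuous hℓ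
  rw [S.h2Deriv.scalarProd_eq D]
  have cw := S.continuous_w
  have cw₁ := S.continuous_w₁
  have ch := S.continuous_h
  have ch₁ := S.continuous_h₁ hf
  have csin : Continuous fun x => Real.sin (m * x) := by fun_prop
  have ccos : Continuous fun x => m * Real.cos (m * x) := by fun_prop
  have csin2 : Continuous fun x => -m ^ 2 * Real.sin (m * x) := by fun_prop
  have int : ∀ {g : ℝ × ℝ → ℝ} {r k : ℝ → ℝ}, MemLp g 2 (volume.restrict (plate ℓ)) →
      Continuous r → Continuous k → IntegrableOn (fun p => g p * (r p.1 * k p.2)) (plate ℓ) := by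
    intro g r k hg hr hk
    rw [volume_restrict_plate] at hg
    rw [IntegrableOn, volume_restrict_plate]
    exact integrable_mul_tensor hg (memLp_of_continuous hr) hk
  have ckA : Continuous fun y => h y - (1 - σ) * (m ^ 2 * w y + h y) := by fun_prop
  have ckB : Continuous fun y => h y + (1 - σ) * m ^ 2 * w y := by fun_prop
  have ckB' : Continuous fun y => h₁ y + (1 - σ) * m ^ 2 * w₁ y := by fun_prop
  have ckC : Continuous fun y => 2 * (1 - σ) * w₁ y := by fun_prop
  have eA := D.integral_xx hV hV0 hvV (hasDerivAt_sin_mul m) (hasDerivAt_mul_cos_mul m) csin2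
    (by simp) hm ckA
  have eB := H2Deriv.integral_y D.yy hℓ D.memLp_y D.memLp_yy csin (memLp_of_continuous ckB')
    (eq_add_integral_of_hasDerivAt
      (fun t => (S.deriv_h t).add ((S.deriv_w t).const_mul ((1 - σ) * m ^ 2))) ckB' (-ℓ))
    ckB (by simp only [Pi.add_apply]; rw [ha.moment]; ring)
    (by simp only [Pi.add_apply]; rw [hb.moment]; ring)
  have eC := D.integral_xy hℓ hV hV0 hvV (hasDerivAt_mul_cos_mul m) csin2 ckC
  -- the shear condition makes the boundary terms of the last integration by parts vanish
  have eD := H2Deriv.integral_y (κ := fun y => h₁ y - (1 - σ) * m ^ 2 * w₁ y)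
    (κ₁ := fun y => (m ^ 2 * h y + f y) - (1 - σ) * m ^ 2 * (m ^ 2 * w y + h y))
    D.y hℓ D.memLp D.memLp_y csin
    (((memLp_of_continuous (by fun_prop)).add hf2).sub (memLp_of_continuous (by fun_prop)))
    (fun x => by
      have c1 : Continuous fun y => (1 - σ) * m ^ 2 * (m ^ 2 * w y + h y) := by fun_prop
      have c2 : Continuous fun y => m ^ 2 * h y := by fun_prop
      rw [intervalIntegral.integral_sub ((c2.intervalIntegrable _ _).add hf.intervalIntegrable)
        (c1.intervalIntegrable _ _), S.h₁_eq hf x]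
      have := eq_add_integral_of_hasDerivAt
        (fun t => (S.deriv_w₁ t).const_mul ((1 - σ) * m ^ 2)) c1 (-ℓ) x
      linarith)
    (by fun_prop) (by rw [ha.shear]; ring) (by rw [hb.shear]; ring)
  have iq : IntegrableOn (fun p => v p * (Real.sin (m * p.1) *
      ((m ^ 2 * h p.2 + f p.2) - (1 - σ) * m ^ 2 * (m ^ 2 * w p.2 + h p.2)))) (plate ℓ) := by
    have hm' := D.memLp
    rw [volume_restrict_plate] at hm'
    rw [IntegrableOn, volume_restrict_plate]
    refine (integrable_mul_tensor (memLp_swap hm') (r := fun y => (m ^ 2 * h y + f y) -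
      (1 - σ) * m ^ 2 * (m ^ 2 * w y + h y)) (((memLp_of_continuous (by fun_prop)).add hf2).sub
        (memLp_of_continuous (by fun_prop))) csin).swap.congr (ae_of_all _ fun p => ?_)
    simp [mul_comm]
  have iA := int D.memLp_xx csin ckA
  have iB := int D.memLp_yy csin ckB
  have iC := int D.memLp_xy ccos ckC
  calc _ = ∫ p in plate ℓ, ((vxx p * (Real.sin (m * p.1) *
          (h p.2 - (1 - σ) * (m ^ 2 * w p.2 + h p.2))) +
        vyy p * (Real.sin (m * p.1) * (h p.2 + (1 - σ) * m ^ 2 * w p.2))) +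
        vxy p * (m * Real.cos (m * p.1) * (2 * (1 - σ) * w₁ p.2))) := by
        congr 1; ext p; ring
    _ = (∫ p in plate ℓ, vxx p * (Real.sin (m * p.1) *
          (h p.2 - (1 - σ) * (m ^ 2 * w p.2 + h p.2)))) +
        (∫ p in plate ℓ, vyy p * (Real.sin (m * p.1) * (h p.2 + (1 - σ) * m ^ 2 * w p.2))) +
        ∫ p in plate ℓ, vxy p * (m * Real.cos (m * p.1) * (2 * (1 - σ) * w₁ p.2)) := by
        have e := integral_add (iA.add iB) iC
        simp only [Pi.add_apply] at e
        rw [e, integral_add iA iB]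
    _ = (∫ p in plate ℓ, v p * (-m ^ 2 * Real.sin (m * p.1) *
          (h p.2 - (1 - σ) * (m ^ 2 * w p.2 + h p.2)))) -
        ((∫ p in plate ℓ, vy p * (Real.sin (m * p.1) * (h₁ p.2 + (1 - σ) * m ^ 2 * w₁ p.2))) +
        ∫ p in plate ℓ, vy p * (-m ^ 2 * Real.sin (m * p.1) * (2 * (1 - σ) * w₁ p.2))) := by
        simp only [Pi.add_apply] at eB
        linarith
    _ = (∫ p in plate ℓ, v p * (-m ^ 2 * Real.sin (m * p.1) *
          (h p.2 - (1 - σ) * (m ^ 2 * w p.2 + h p.2)))) -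
        ∫ p in plate ℓ, vy p * (Real.sin (m * p.1) * (h₁ p.2 - (1 - σ) * m ^ 2 * w₁ p.2)) := by
        rw [← integral_add (int D.memLp_y csin ckB') (int D.memLp_y csin2 ckC)]
        congr 2; ext p; ring
    _ = ∫ p in plate ℓ, f p.2 * Real.sin (m * p.1) * v p := by
        rw [eD, sub_neg_eq_add, ← integral_add (int D.memLp csin2 ckA) iq]
        congr 1; ext p; ring

/-- A continuous function on a rectangle that is orthogonal to all products of continuous
functions vanishes. -/
theorem eq_zero_of_integral_tensor_eq_zero {a b c d : ℝ} (hab : a < b) (hcd : c < d)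
    {Z : ℝ × ℝ → ℝ} (hZ : Continuous Z)
    (h : ∀ φ k : ℝ → ℝ, Continuous φ → Continuous k →
      ∫ p, Z p * (φ p.1 * k p.2) ∂rectMeasure a b c d = 0) :
    ∀ p ∈ Icc a b ×ˢ Icc c d, Z p = 0 := by
  have sq0 : ∀ {a b : ℝ}, a < b → ∀ g : ℝ → ℝ, Continuous g → ∫ t in a..b, g t * g t = 0 →
      ∀ t ∈ Icc a b, g t = 0 := by
    intro a b hab g hg h0
    by_contra! hne
    obtain ⟨t, ht, hgt⟩ := hne
    have := intervalIntegral.integral_pos hab (hg.fun_mul hg).continuousOn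
      (fun t _ => mul_self_nonneg (g t)) ⟨t, ht, mul_self_pos.2 hgt⟩
    linarith
  have hL : MemLp Z 2 (rectMeasure a b c d) := by
    rw [← volume_restrict_prod]
    exact memLp_restrict_of_continuous ((Metric.isBounded_Ioo _ _).prod (Metric.isBounded_Ioo _ _))
      (measurableSet_Ioo.prod measurableSet_Ioo) hZ
  have slice : ∀ φ : ℝ → ℝ, Continuous φ → ∀ y ∈ Icc c d, ∫ x in a..b, Z (x, y) * φ x = 0 := by
    intro φ hφ
    have hc : Continuous fun y => ∫ x in a..b, Z (x, y) * φ x :=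
      intervalIntegral.continuous_parametric_intervalIntegral_of_continuous'
        (f := fun y x => Z (x, y) * φ x) (by fun_prop) a b
    refine sq0 hcd _ hc ?_
    have e := h φ _ hφ hc
    rw [integral_prod_symm _ (integrable_mul_tensor hL (memLp_of_continuous hφ) hc)] at e
    rw [← setIntegral_Ioo_eq_intervalIntegral hcd.le, ← e]
    congr 1
    ext y
    simp only [← mul_assoc]
    rw [integral_mul_const, setIntegral_Ioo_eq_intervalIntegral hab.le]
  rintro ⟨x, y⟩ ⟨hx, hy⟩
  have hc : Continuous fun x => Z (x, y) := by fun_prop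
  exact sq0 hab (fun x => Z (x, y)) hc (slice _ hc y hy) x hx

/-- Every continuous `φ` is the second derivative of a function vanishing at `0` and `b`. -/
theorem exists_second_primitive {φ : ℝ → ℝ} (hφ : Continuous φ) {b : ℝ} (hb : b ≠ 0) :
    ∃ β β₁ : ℝ → ℝ, (∀ t, HasDerivAt β (β₁ t) t) ∧ (∀ t, HasDerivAt β₁ (φ t) t) ∧
      β 0 = 0 ∧ β b = 0 := by
  have h1 : ∀ t, HasDerivAt (fun t => ∫ r in (0)..t, φ r) (φ t) t := fun t =>
    (hφ.integral_hasStrictDerivAt 0 t).hasDerivAt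
  have hc : Continuous fun t => ∫ r in (0)..t, φ r :=
    continuous_iff_continuousAt.2 fun t => (h1 t).continuousAt
  have h2 : ∀ t, HasDerivAt (fun t => ∫ x in (0)..t, ∫ r in (0)..x, φ r) (∫ r in (0)..t, φ r) t :=
    fun t => (hc.integral_hasStrictDerivAt 0 t).hasDerivAt
  refine ⟨fun t => (∫ x in (0)..t, ∫ r in (0)..x, φ r) -
      (∫ x in (0)..b, ∫ r in (0)..x, φ r) / b * t,
    fun t => (∫ r in (0)..t, φ r) - (∫ x in (0)..b, ∫ r in (0)..x, φ r) / b, fun t => ?_,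
    fun t => (h1 t).sub_const _, by simp, by field_simp; ring⟩
  convert! (h2 t).sub
    ((hasDerivAt_id t).const_mul ((∫ x in (0)..b, ∫ r in (0)..x, φ r) / b)) using 1
  simp

/-- A function of `H²_*(Ω)` with `z_xx = 0` vanishes. -/
theorem MemH2Star.ae_eq_zero (hℓ : 0 < ℓ) {z zx zy zxx zxy zyy : ℝ × ℝ → ℝ} (hz : MemH2Star ℓ z)
    (D : H2Deriv ℓ z zx zy zxx zxy zyy) (h0 : zxx =ᵐ[volume.restrict (plate ℓ)] 0) :
    z =ᵐ[volume.restrict (plate ℓ)] 0 := by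
  obtain ⟨Z, hZ, hZ0, hzZ⟩ := hz.exists_continuous hℓ
  have key := eq_zero_of_integral_tensor_eq_zero Real.pi_pos (by linarith : -ℓ < ℓ) hZ (by
    intro φ k hφ hk
    obtain ⟨β, β₁, hβ, hβ₁, hβ0, hβπ⟩ := exists_second_primitive hφ Real.pi_ne_zero
    have e := D.integral_xx hZ hZ0 hzZ hβ hβ₁ hφ hβ0 hβπ hk
    rw [integral_eq_zero_of_ae (by filter_upwards [h0] with p hp; simp [hp])] at e
    rw [← volume_restrict_plate, e]
    exact integral_congr_ae (by filter_upwards [hzZ] with p hp; rw [hp]))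
  filter_upwards [hzZ, ae_restrict_mem (isOpen_plate ℓ).measurableSet] with p hp hpm
  rw [hp, key p ⟨Ioo_subset_Icc_self hpm.1, Ioo_subset_Icc_self hpm.2⟩, Pi.zero_apply]

theorem MemH2Star.sub {u v : ℝ × ℝ → ℝ} (hu : MemH2Star ℓ u) (hv : MemH2Star ℓ v) :
    MemH2Star ℓ (u - v) := by
  obtain ⟨h1, U, hU, huU, hU0⟩ := hu
  obtain ⟨k1, V, hV, hvV, hV0⟩ := hv
  exact ⟨h1.sub k1, U - V, hU.sub hV, huU.sub hvV, fun y hy => by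
    simp [(hU0 y hy).1, (hU0 y hy).2, (hV0 y hy).1, (hV0 y hy).2]⟩

/-- Uniqueness of the weak solution. -/
theorem IsWeakSolution.ae_eq {σ : ℝ} (hℓ : 0 < ℓ) (hσ0 : 0 < σ) (hσ1 : σ < 1) {F u v : ℝ × ℝ → ℝ}
    (hu : IsWeakSolution ℓ σ F u) (hv : IsWeakSolution ℓ σ F v) :
    u =ᵐ[volume.restrict (plate ℓ)] v := by
  obtain ⟨ux, uy, uxx, uxy, uyy, Du⟩ := hu.1.1.exists_h2Deriv
  obtain ⟨vx, vy, vxx, vxy, vyy, Dv⟩ := hv.1.1.exists_h2Deriv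
  have D := Du.sub Dv
  have hz := hu.1.sub hv.1
  have e : scalarProd ℓ σ u (u - v) - scalarProd ℓ σ v (u - v) = 0 := by
    rw [hu.2 _ hz, hv.2 _ hz, sub_self]
  rw [Du.scalarProd_eq D, Dv.scalarProd_eq D,
    ← integral_sub (Du.integrable_energy D σ) (Dv.integrable_energy D σ)] at e
  -- the energy density is `(1 - σ) (a² + b² + 2 c²) + σ (a + b)²` with `a, b, c` the second
  -- derivatives of `u - v`
  have hid : ∀ p, ((uxx p + uyy p) * ((uxx - vxx) p + (uyy - vyy) p) +
        (1 - σ) * (2 * uxy p * (uxy - vxy) p - uxx p * (uyy - vyy) p - uyy p * (uxx - vxx) p)) -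
      ((vxx p + vyy p) * ((uxx - vxx) p + (uyy - vyy) p) +
        (1 - σ) * (2 * vxy p * (uxy - vxy) p - vxx p * (uyy - vyy) p - vyy p * (uxx - vxx) p)) =
      (1 - σ) * ((uxx - vxx) p ^ 2 + (uyy - vyy) p ^ 2 + 2 * (uxy - vxy) p ^ 2) +
        σ * ((uxx - vxx) p + (uyy - vyy) p) ^ 2 := fun p => by
    simp only [Pi.sub_apply]; ring
  have hs : 0 < 1 - σ := by linarith
  have i0 := ((Du.integrable_energy D σ).sub (Dv.integrable_energy D σ)).congr (ae_of_all _ hid)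
  simp only [hid] at e
  have h0 := (integral_eq_zero_iff_of_nonneg_ae
    (ae_of_all _ fun p => by simp only [Pi.zero_apply]; positivity) i0).1 e
  have hxx : (uxx - vxx) =ᵐ[volume.restrict (plate ℓ)] 0 := by
    filter_upwards [h0] with p hp
    simp only [Pi.zero_apply] at hp
    have h1 : 0 ≤ (1 - σ) * ((uyy - vyy) p ^ 2 + 2 * (uxy - vxy) p ^ 2) +
        σ * ((uxx - vxx) p + (uyy - vyy) p) ^ 2 := by positivity
    have h2 : (1 - σ) * (uxx - vxx) p ^ 2 ≤ 0 := by linarith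
    have h3 : (uxx - vxx) p ^ 2 ≤ 0 := nonpos_of_mul_nonpos_right h2 hs
    simpa using le_antisymm h3 (sq_nonneg _)
  filter_upwards [hz.ae_eq_zero hℓ D hxx] with p hp
  simpa [sub_eq_zero] using hp

end HingedPlate

theorem mainTheorem4 (ℓ σ : ℝ) (hℓ : 0 < ℓ) (hσ0 : 0 < σ) (hσ1 : σ < 1 / 2)
    (m : ℕ) (hm : 1 ≤ m) (f : ℝ → ℝ)
    (hf : MeasureTheory.MemLp f 2 (MeasureTheory.volume.restrict (Set.Ioo (-ℓ) ℓ)))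
    (u : ℝ × ℝ → ℝ)
    (hu : HingedPlate.IsWeakSolution ℓ σ (fun p => f p.2 * Real.sin (m * p.1)) u) :
    ∃ w : ℝ → ℝ,
      HingedPlate.MemH (Set.Ioo (-ℓ) ℓ) 2 w ∧ ContinuousOn w (Set.Icc (-ℓ) ℓ) ∧
      (∀ᵐ p ∂(MeasureTheory.volume.restrict (HingedPlate.plate ℓ)),
        u p = w p.2 * Real.sin (m * p.1)) ∧
      ((∀ᵐ y ∂(MeasureTheory.volume.restrict (Set.Ioo (-ℓ) ℓ)), 0 ≤ f y) →
        (¬ ∀ᵐ y ∂(MeasureTheory.volume.restrict (Set.Ioo (-ℓ) ℓ)), f y = 0) →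
        ∀ y ∈ Set.Icc (-ℓ) ℓ, 0 < w y) := by
  have hm0 : (0 : ℝ) < m := by exact_mod_cast hm
  have hlt : -ℓ < ℓ := by linarith
  have hs0 : 0 < 1 - σ := by linarith
  have hs1 : 1 - σ < 1 := by linarith
  -- `f` is extended by zero to the whole line
  set f₀ := (Ioo (-ℓ) ℓ).indicator f with hf₀
  have hff : f₀ =ᵐ[volume.restrict (Ioo (-ℓ) ℓ)] f := indicator_ae_eq_restrict measurableSet_Ioo
  have hi : Integrable f₀ := (integrable_indicator_iff measurableSet_Ioo).2
    (hf.integrable one_le_two)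
  obtain ⟨w, w₁, h, h₁, S, ha, hb⟩ := HingedPlate.exists_modeSystem hm0.ne' hs0 hs1 hlt hi
  have cw := S.continuous_w
  have ch := S.continuous_h
  have hw2 : ContDiff ℝ 2 w :=
    HingedPlate.contDiff_two_of_hasDerivAt S.deriv_w S.deriv_w₁ (by fun_prop)
  refine ⟨w, HingedPlate.memH_of_contDiff (Metric.isBounded_Ioo _ _) measurableSet_Ioo 2 hw2,
    cw.continuousOn, ?_, fun hf0 hne y hy => ?_⟩
  · have hsin : Real.sin (m * Real.pi) = 0 := Real.sin_nat_mul_pi m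
    have hsol : HingedPlate.IsWeakSolution ℓ σ (fun p => f p.2 * Real.sin (m * p.1))
        (fun p => Real.sin (m * p.1) * w p.2) := by
      refine ⟨HingedPlate.memH2Star_tensor (β := fun x => Real.sin (m * x)) (by fun_prop) hw2
        (by simp) hsin, fun v hv => ?_⟩
      rw [S.scalarProd_eq hℓ hsin hi (hf.ae_eq hff.symm) ha hb hv]
      refine setIntegral_congr_fun (HingedPlate.isOpen_plate ℓ).measurableSet fun p hp => ?_
      simp only [hf₀, indicator_of_mem hp.2]
    filter_upwards [hu.ae_eq hℓ hσ0 (by linarith) hsol] with p hp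
    rw [hp, mul_comm]
  · have hf00 : 0 ≤ᵐ[volume] f₀ := by
      filter_upwards [(ae_restrict_iff' measurableSet_Ioo).1 hf0] with t ht
      exact indicator_nonneg (fun _ => ht) t
    refine lt_of_le_of_ne ((S.nonneg_and_nonpos hm0 hs0 hs1 hlt ha hb hi hf00).1 y hy) fun hwy =>
      hne ?_
    filter_upwards [hff, S.ae_eq_zero_of_eq_zero hm0 hs0 hs1 hlt ha hb hi hf00 hy hwy.symm]
      with t h1 h2
    rw [← h1, h2]
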